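/- A state on $\mathbb{C}^d$ is a positive semidefinite matrix $\rho\in\mathbb{C}^{d\times d}$ with $\mathrm{tr}\,\rho=1$; an observable is a Hermitian matrix $O\in\mathbb{C}^{d\times d}$, and $\|O\|$ is its operator norm. A classical-shadows algorithm for dimension $d$ using $n$ copies applies a (possibly entangled and randomized) POVM to $\rho^{\otimes n}$ and stores the classical outcome $z$; the POVM does not depend on any observable. Afterwards, given an observable $O$, it outputs an estimate $\tau=\tau(O,z)\in\mathbb{R}$ that depends only on $O$ and $z$. The algorithm solves classical shadows with parameters $d,\epsilon$ with probability $p$ if for every state $\rho$ on $\mathbb{C}^d$ and every observable $O$, with probability at least $p$, \[ |\mathrm{tr}(O\rho)-\tau|\le \epsilon\,\|O\| . \] Theorem. There is a universal constant $C>0$ such that the following holds. Let $\epsilon>0$ and let $d,k$ be integers with $d\ge k\ge 100\sqrt d/\epsilon$. Suppose that some algorithm using $f$ copies solves classical shadows with parameters $k,\ 0.01\,\epsilon k/d$ with probability $0.9$. Then for every $\delta\in(0,1/2]$ there is an algorithm that solves classical shadows with parameters $d,\epsilon$ with probability $1-\delta$ and uses at most \[ C\,\bigl(f+1/\epsilon^2\bigr)\,\log(1/\delta)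 \] copies. -/

import Mathlib

open MeasureTheory
open scoped ComplexOrder

noncomputable section

namespace Shadows

/-- A (mixed) quantum state on `ℂ^ι`: a positive semidefinite matrix of trace one. -/
def IsState {ι : Type} [Fintype ι] (ρ : Matrix ι ι ℂ) : Prop :=
  ρ.PosSemidef ∧ ρ.trace = 1

/-- The operator norm `‖O‖` of a matrix acting on the Hilbert space `ℂ^d`. -/
def opNorm {d : ℕ} (O : Matrix (Fin d) (Fin d) ℂ) : ℝ :=
  ‖Matrix.toEuclideanCLM (n := Fin d) (𝕜 := ℂ) O‖

/-- `n` copies of `ρ`: the matrix of `ρ^{⊗ n}` on `(ℂ^d)^{⊗ n}`, in the product basis indexed by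
`Fin n → Fin d`. -/
def tensorPower {d : ℕ} (n : ℕ) (ρ : Matrix (Fin d) (Fin d) ℂ) :
    Matrix (Fin n → Fin d) (Fin n → Fin d) ℂ :=
  Matrix.of fun x y => ∏ i, ρ (x i) (y i)

/-- A POVM `{M_z dμ(z)}` on `ℂ^ι` with outcomes in an arbitrary measurable space `Ω`: a measurable
family of positive semidefinite matrices with `∫ M_z dμ(z) = 1` (entrywise). Since `ℂ^ι` is finite
dimensional, every positive-operator-valued measure `E` on `Ω` has this form, for instance with
`μ = tr E` and `M = dE/dμ`; discrete POVMs are the case of a counting measure. -/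
structure POVM (ι : Type) [Fintype ι] [DecidableEq ι] (Ω : Type) [MeasurableSpace Ω] where
  μ : Measure Ω
  sigmaFinite : SigmaFinite μ
  elem : Ω → Matrix ι ι ℂ
  measurable_elem : ∀ i j, Measurable fun z => elem z i j
  posSemidef_elem : ∀ z, (elem z).PosSemidef
  integrable_elem : ∀ i j, Integrable (fun z => elem z i j) μ
  integral_elem : ∀ i j, ∫ z, elem z i j ∂μ = (1 : Matrix ι ι ℂ) i j

/-- Born's rule: the law of the outcome when the state `σ` is measured,
`dP(z) = tr(M_z σ) dμ(z)`. -/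
def POVM.law {ι : Type} [Fintype ι] [DecidableEq ι] {Ω : Type} [MeasurableSpace Ω]
    (M : POVM ι Ω) (σ : Matrix ι ι ℂ) : Measure Ω :=
  M.μ.withDensity fun z => ENNReal.ofReal (M.elem z * σ).trace.re

/-- A classical-shadows algorithm on `n` copies of a `d`-dimensional state. In the measurement
phase it applies a (possibly entangled) POVM to `ρ^{⊗ n}` and stores the outcome `z : Ω`; neither
depends on the observable. In the estimation phase it answers a query `O` with `estimate O z`.
Adaptive measurements and all internal randomness (including random bits that are to be used in the
estimation phase) are part of the POVM and of its outcome. -/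
structure Algorithm (d n : ℕ) where
  Ω : Type
  mΩ : MeasurableSpace Ω
  povm : POVM (Fin n → Fin d) Ω
  estimate : Matrix (Fin d) (Fin d) ℂ → Ω → ℝ
  measurable_estimate : ∀ O : Matrix (Fin d) (Fin d) ℂ, O.IsHermitian → Measurable (estimate O)

/-- The algorithm solves classical shadows to accuracy `ε` with probability `p`: for every state
`ρ` and every observable (Hermitian matrix) `O`, with probability at least `p` the estimate `τ`
satisfies `|tr(O ρ) - τ| ≤ ε ‖O‖`. -/
def Algorithm.Solves {d n : ℕ} (A : Algorithm d n) (ε p : ℝ) : Prop :=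
  letI := A.mΩ
  ∀ ρ : Matrix (Fin d) (Fin d) ℂ, IsState ρ →
    ∀ O : Matrix (Fin d) (Fin d) ℂ, O.IsHermitian →
      ENNReal.ofReal p ≤ A.povm.law (tensorPower n ρ)
        {z | |(O * ρ).trace.re - A.estimate O z| ≤ ε * opNorm O}

end Shadows

/-!
Compress `ρ` from dimension `d` to dimension `k = k₁ + k₂` by a random channel with Kraus operators
`(V_j; W_j) / √τ`, where `τ = 30 d`, `j` ranges over `m ≈ 8 d / k` values and the entries of
`V = (V_j)_j` (`k₁` rows) and `W = (W_j)_j` (`k₂` rows) are independent uniform fourth roots of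
unity. A net argument shows that these operators form a subchannel with high probability. The
missing mass is sent to a single basis vector, where an observable with zero diagonal does not see
it. Accordingly a query `O` is replaced by the Hermitian matrix with zero diagonal blocks and
off-diagonal block `X = V (1 ⊗ O) Wᴴ`. Its expectation after the compression is
`2 / τ * Re tr (V M Vᴴ)` with `M = (1 ⊗ O) Wᴴ W (1 ⊗ ρ)`. Chebyshev's inequality, applied first to
`tr M` as a quadratic form in `W` and then to `tr (V M Vᴴ)` as a quadratic form in `V`, shows that
`tr (V M Vᴴ)` is close to its mean `m k₁ k₂ tr (O ρ)`. A net argument also gives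
`‖X‖ = O(d ‖O‖)`, so the accuracy `0.01 ε k / d` in dimension `k` becomes an error below `ε ‖O‖`
after rescaling by `τ / (2 m k₁ k₂)`. The resulting success probability exceeds `1 / 2`, and the
median of `O(log (1 / δ))` independent runs raises it to `1 - δ`.
-/

noncomputable section

namespace Shadows

open scoped Matrix BigOperators ComplexConjugate

section Matrices

variable {ι κ J X Y Z R : Type*} [Fintype ι] [Fintype κ] [Fintype J]

lemma exists_eq_conjTranspose_mul_self {A : Matrix ι ι ℂ} (hA : A.PosSemidef) :
    ∃ B : Matrix ι ι ℂ, A = Bᴴ * B := by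
  classical
  open scoped MatrixOrder Matrix.Norms.L2Operator in
  exact CStarAlgebra.nonneg_iff_eq_star_mul_self.mp hA.nonneg

lemma trace_mul_nonneg {A B : Matrix ι ι ℂ} (hA : A.PosSemidef) (hB : B.PosSemidef) :
    0 ≤ (A * B).trace := by
  obtain ⟨C, rfl⟩ := exists_eq_conjTranspose_mul_self hA
  rw [Matrix.mul_assoc, Matrix.trace_mul_comm]
  exact (hB.mul_mul_conjTranspose_same C).trace_nonneg

lemma ofReal_re_trace_mul {A B : Matrix ι ι ℂ} (hA : A.PosSemidef) (hB : B.PosSemidef) :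
    (((A * B).trace.re : ℝ) : ℂ) = (A * B).trace :=
  (Complex.eq_re_of_ofReal_le (trace_mul_nonneg hA hB)).symm

lemma re_trace_mul_nonneg {A B : Matrix ι ι ℂ} (hA : A.PosSemidef) (hB : B.PosSemidef) :
    0 ≤ (A * B).trace.re :=
  (Complex.nonneg_iff.mp (trace_mul_nonneg hA hB)).1

lemma trace_submatrix_equiv (A : Matrix ι ι ℂ) (e : κ ≃ ι) : (A.submatrix e e).trace = A.trace :=
  e.sum_comp fun i => A i i

lemma conjTranspose_mul_mul_apply (A : Matrix ι ι ℂ) (K : Matrix ι X ℂ) (i j : X) :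
    (Kᴴ * A * K) i j = (A * Matrix.vecMulVec (K.col j) (star (K.col i))).trace := by
  simp only [Matrix.trace, Matrix.diag_apply, Matrix.mul_apply, Finset.sum_mul,
    Matrix.conjTranspose_apply, Matrix.vecMulVec_apply, Matrix.col_apply, Pi.star_apply]
  rw [Finset.sum_comm]
  exact Finset.sum_congr rfl fun a _ => Finset.sum_congr rfl fun b _ => by ring

lemma conjTranspose_mul_self_apply (K : Matrix ι X ℂ) (i j : X) :
    (Kᴴ * K) i j = (Matrix.vecMulVec (K.col j) (star (K.col i))).trace := by
  simp only [Matrix.trace, Matrix.diag_apply, Matrix.mul_apply, Matrix.conjTranspose_apply,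
    Matrix.vecMulVec_apply, Matrix.col_apply, Pi.star_apply, mul_comm]

/-- The tensor product of a finite family of matrices, in the product bases. -/
def tensorMat (K : J → Matrix X Y ℂ) : Matrix (J → X) (J → Y) ℂ :=
  Matrix.of fun x y => ∏ i, K i (x i) (y i)

lemma tensorMat_mul [DecidableEq J] [Fintype Y] (K : J → Matrix X Y ℂ) (L : J → Matrix Y Z ℂ) :
    tensorMat K * tensorMat L = tensorMat fun i => K i * L i := by
  ext x z
  simp only [tensorMat, Matrix.mul_apply, Matrix.of_apply, ← Finset.prod_mul_distrib]
  rw [Finset.prod_univ_sum, Fintype.piFinset_univ]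

lemma tensorMat_conjTranspose (K : J → Matrix X Y ℂ) :
    (tensorMat K)ᴴ = tensorMat fun i => (K i)ᴴ := by
  ext x z
  simp [tensorMat, Matrix.conjTranspose_apply]

lemma tensorMat_one [DecidableEq X] : tensorMat (fun _ : J => (1 : Matrix X X ℂ)) = 1 := by
  ext x y
  simp only [tensorMat, Matrix.of_apply, Matrix.one_apply, funext_iff]
  rw [Finset.prod_ite_zero]
  simp

lemma trace_tensorMat [DecidableEq J] [Fintype X] (K : J → Matrix X X ℂ) :
    (tensorMat K).trace = ∏ i, (K i).trace := by
  simp only [Matrix.trace, Matrix.diag_apply, tensorMat, Matrix.of_apply]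
  rw [Finset.prod_univ_sum, Fintype.piFinset_univ]

lemma sum_tensorMat [DecidableEq J] [Fintype R] (K : J → R → Matrix X Y ℂ) :
    ∑ r : J → R, tensorMat (fun i => K i (r i)) = tensorMat fun i => ∑ r, K i r := by
  ext x y
  simp only [tensorMat, Matrix.of_apply, Matrix.sum_apply]
  rw [Finset.prod_univ_sum, Fintype.piFinset_univ]

lemma posSemidef_tensorMat [Finite X] {K : J → Matrix X X ℂ} (hK : ∀ i, (K i).PosSemidef) :
    (tensorMat K).PosSemidef := by
  classical
  cases nonempty_fintype X
  choose B hB using fun i => exists_eq_conjTranspose_mul_self (hK i)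
  have hKB : tensorMat K = (tensorMat B)ᴴ * tensorMat B := by
    rw [tensorMat_conjTranspose, tensorMat_mul]
    exact congrArg tensorMat (funext hB)
  rw [hKB]
  exact Matrix.posSemidef_conjTranspose_mul_self _

lemma tensorPower_eq_tensorMat {d : ℕ} (n : ℕ) (ρ : Matrix (Fin d) (Fin d) ℂ) :
    tensorPower n ρ = tensorMat fun _ : Fin n => ρ := rfl

end Matrices

lemma isState_tensorMat {J X : Type} [Fintype J] [DecidableEq J] [Fintype X]
    {σ : J → Matrix X X ℂ} (hσ : ∀ i, IsState (σ i)) : IsState (tensorMat σ) :=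
  ⟨posSemidef_tensorMat fun i => (hσ i).1, by simp [trace_tensorMat, (hσ _).2]⟩

lemma isState_tensorPower {d n : ℕ} {ρ : Matrix (Fin d) (Fin d) ℂ} (hρ : IsState ρ) :
    IsState (tensorPower n ρ) :=
  isState_tensorMat fun _ => hρ

/-- The quantum channel `σ ↦ ∑ r, K r σ (K r)ᴴ` with Kraus operators `K`; it is trace preserving
when `∑ r, (K r)ᴴ K r = 1`. -/
def krausMap {ι κ R : Type*} [Fintype ι] [Fintype R] (K : R → Matrix κ ι ℂ) (σ : Matrix ι ι ℂ) :
    Matrix κ κ ℂ :=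
  ∑ r, K r * σ * (K r)ᴴ

section Kraus

variable {ι κ J R : Type*} [Fintype R]

lemma trace_mul_krausMap [Fintype ι] [Fintype κ] (K : R → Matrix κ ι ℂ) (A : Matrix κ κ ℂ)
    (σ : Matrix ι ι ℂ) : (A * krausMap K σ).trace = ((∑ r, (K r)ᴴ * A * K r) * σ).trace := by
  simp only [krausMap, Matrix.mul_sum, Matrix.sum_mul, Matrix.trace_sum]
  refine Finset.sum_congr rfl fun r _ => ?_
  rw [← Matrix.mul_assoc, Matrix.trace_mul_comm]
  simp only [Matrix.mul_assoc]

variable [Fintype J] [DecidableEq J]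

lemma krausMap_tensorMat [Fintype ι] (K : R → Matrix κ ι ℂ) (σ : Matrix ι ι ℂ) :
    krausMap (fun r : J → R => tensorMat fun i => K (r i)) (tensorMat fun _ : J => σ) =
      tensorMat fun _ : J => krausMap K σ := by
  simp only [krausMap, tensorMat_conjTranspose, tensorMat_mul]
  rw [sum_tensorMat fun _ : J => fun r => K r * σ * (K r)ᴴ]

lemma sum_tensorMat_conjTranspose_mul_self [Fintype κ] [DecidableEq ι] {K : R → Matrix κ ι ℂ}
    (hK : ∑ r, (K r)ᴴ * K r = 1) :
    ∑ r : J → R, (tensorMat fun i => K (r i))ᴴ * (tensorMat fun i => K (r i)) = 1 := by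
  simp only [tensorMat_conjTranspose, tensorMat_mul]
  rw [sum_tensorMat fun _ : J => fun r => (K r)ᴴ * K r, hK, tensorMat_one]

end Kraus

lemma isState_krausMap {ι κ R : Type} [Fintype ι] [DecidableEq ι] [Fintype κ] [Fintype R]
    {K : R → Matrix κ ι ℂ} (hK : ∑ r, (K r)ᴴ * K r = 1) {ρ : Matrix ι ι ℂ} (hρ : IsState ρ) :
    IsState (krausMap K ρ) := by
  classical
  refine ⟨Matrix.posSemidef_sum _ fun r _ => hρ.1.mul_mul_conjTranspose_same _, ?_⟩
  have htrace := trace_mul_krausMap K 1 ρ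
  simpa only [Matrix.one_mul, Matrix.mul_one, hK, hρ.2] using htrace

section Measure

variable {G J Ω : Type*} [Fintype J] [MeasurableSpace G] [MeasurableSingletonClass G]
  [MeasurableSpace Ω]

lemma integrable_sum_map_prodMk [Finite G] {μ : G → Measure Ω} {F : G × Ω → ℂ} {c : NNReal}
    (hF : ∀ g, Integrable (fun z => F (g, z)) (μ g)) :
    Integrable F (Measure.sum fun g => c • (μ g).map (Prod.mk g)) := by
  cases nonempty_fintype G
  rw [Measure.sum_fintype, integrable_finsetSum_measure]
  exact fun g _ => ((measurableEmbedding_prodMk_left g).integrable_map_iff.mpr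
    (hF g)).smul_measure_nnreal

lemma integral_sum_map_prodMk [Fintype G] {μ : G → Measure Ω} {F : G × Ω → ℂ} {c : NNReal}
    (hF : ∀ g, Integrable (fun z => F (g, z)) (μ g)) :
    ∫ p, F p ∂(Measure.sum fun g => c • (μ g).map (Prod.mk g)) =
      c • ∑ g, ∫ z, F (g, z) ∂μ g := by
  rw [integral_sum_measure (integrable_sum_map_prodMk hF), tsum_fintype, Finset.smul_sum]
  refine Finset.sum_congr rfl fun g _ => ?_
  rw [integral_smul_nnreal_measure, (measurableEmbedding_prodMk_left g).integral_map]

lemma lintegral_pi_prod_ofReal {μ : Measure Ω} [SigmaFinite μ] {p : J → Ω → ℝ}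
    (hp : ∀ i z, 0 ≤ p i z) (hint : ∀ i, Integrable (p i) μ) :
    ∫⁻ z, ∏ i, ENNReal.ofReal (p i (z i)) ∂(Measure.pi fun _ => μ) =
      ∏ i, ∫⁻ z, ENNReal.ofReal (p i z) ∂μ := by
  simp only [← ofReal_integral_eq_lintegral_ofReal (hint _) (.of_forall (hp _)),
    ← ENNReal.ofReal_prod_of_nonneg fun i _ => hp i _]
  rw [← ENNReal.ofReal_prod_of_nonneg fun i _ => integral_nonneg (hp i),
    ← integral_fintype_prod_eq_prod, ofReal_integral_eq_lintegral_ofReal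
      (Integrable.fintype_prod hint) (.of_forall fun z => Finset.prod_nonneg fun i _ => hp i _)]

lemma withDensity_pi_ofReal {μ : Measure Ω} [SigmaFinite μ] {p : Ω → ℝ} (hp : ∀ z, 0 ≤ p z)
    (hint : Integrable p μ) :
    (Measure.pi fun _ : J => μ).withDensity (fun z => ∏ i, ENNReal.ofReal (p (z i))) =
      Measure.pi fun _ : J => μ.withDensity fun z => ENNReal.ofReal (p z) := by
  classical
  have := isFiniteMeasure_withDensity_ofReal hint.2
  refine (Measure.pi_eq fun s hs => ?_).symm
  have hindicator : (Set.univ.pi s).indicator (fun z => ∏ i, ENNReal.ofReal (p (z i))) =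
      fun z => ∏ i, ENNReal.ofReal ((s i).indicator p (z i)) := by
    funext z
    by_cases hz : z ∈ Set.univ.pi s
    · rw [Set.indicator_of_mem hz]
      exact Finset.prod_congr rfl fun i _ => by rw [Set.indicator_of_mem (hz i trivial)]
    · obtain ⟨i, hi⟩ : ∃ i, z i ∉ s i := by simpa [Set.mem_univ_pi] using hz
      rw [Set.indicator_of_notMem hz, Finset.prod_eq_zero (Finset.mem_univ i)]
      rw [Set.indicator_of_notMem hi, ENNReal.ofReal_zero]
  rw [withDensity_apply _ (.univ_pi hs), ← lintegral_indicator (.univ_pi hs), hindicator,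
    lintegral_pi_prod_ofReal (fun i => Set.indicator_nonneg fun z _ => hp z)
      fun i => hint.indicator (hs i)]
  refine Finset.prod_congr rfl fun i _ => ?_
  rw [withDensity_apply _ (hs i), ← lintegral_indicator (hs i)]
  exact lintegral_congr fun z => by by_cases hz : z ∈ s i <;> simp [hz]

end Measure

namespace POVM

variable {ι κ : Type} [Fintype ι] [DecidableEq ι] [Fintype κ] [DecidableEq κ]
  {Ω : Type} [MeasurableSpace Ω]

lemma trace_elem_mul (M : POVM ι Ω) (σ : Matrix ι ι ℂ) (z : Ω) :
    (M.elem z * σ).trace = ∑ i, ∑ j, M.elem z i j * σ j i := by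
  simp [Matrix.trace, Matrix.mul_apply]

lemma measurable_trace (M : POVM ι Ω) (σ : Matrix ι ι ℂ) :
    Measurable fun z => (M.elem z * σ).trace := by
  simp only [trace_elem_mul]
  exact Finset.measurable_sum _ fun i _ => Finset.measurable_sum _ fun j _ =>
    (M.measurable_elem i j).mul_const _

lemma integrable_trace (M : POVM ι Ω) (σ : Matrix ι ι ℂ) :
    Integrable (fun z => (M.elem z * σ).trace) M.μ := by
  simp only [trace_elem_mul]
  exact integrable_finsetSum _ fun i _ => integrable_finsetSum _ fun j _ =>
    (M.integrable_elem i j).mul_const _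

lemma integral_trace (M : POVM ι Ω) (σ : Matrix ι ι ℂ) :
    ∫ z, (M.elem z * σ).trace ∂M.μ = σ.trace := by
  have hint : ∀ i j, Integrable (fun z => M.elem z i j * σ j i) M.μ := fun i j =>
    (M.integrable_elem i j).mul_const _
  simp only [trace_elem_mul]
  rw [integral_finsetSum _ fun i _ => integrable_finsetSum _ fun j _ => hint i j]
  simp only [integral_finsetSum _ fun j _ => hint _ j, integral_mul_const, M.integral_elem,
    Matrix.one_apply, ite_mul, one_mul, zero_mul, Finset.sum_ite_eq, Finset.mem_univ, if_true,
    Matrix.trace, Matrix.diag_apply]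

lemma measurable_density (M : POVM ι Ω) (σ : Matrix ι ι ℂ) :
    Measurable fun z => ENNReal.ofReal (M.elem z * σ).trace.re :=
  (Complex.measurable_re.comp (M.measurable_trace σ)).ennreal_ofReal

lemma law_apply (M : POVM ι Ω) (σ : Matrix ι ι ℂ) {S : Set Ω} (hS : MeasurableSet S) :
    M.law σ S = ∫⁻ z in S, ENNReal.ofReal (M.elem z * σ).trace.re ∂M.μ :=
  withDensity_apply _ hS

lemma law_univ (M : POVM ι Ω) {σ : Matrix ι ι ℂ} (hσ : σ.PosSemidef) :
    M.law σ Set.univ = ENNReal.ofReal σ.trace.re := by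
  have hnonneg : ∀ z, 0 ≤ (M.elem z * σ).trace.re := fun z =>
    re_trace_mul_nonneg (M.posSemidef_elem z) hσ
  have hint := integral_re (M.integrable_trace σ)
  simp only [RCLike.re_eq_complex_re, M.integral_trace] at hint
  rw [law_apply _ _ MeasurableSet.univ, setLIntegral_univ, ← hint,
    ofReal_integral_eq_lintegral_ofReal (by exact (M.integrable_trace σ).re) (.of_forall hnonneg)]

lemma isProbabilityMeasure_law (M : POVM ι Ω) {σ : Matrix ι ι ℂ} (hσ : IsState σ) :
    IsProbabilityMeasure (M.law σ) :=
  ⟨by simp [M.law_univ hσ.1, hσ.2]⟩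

/-- Apply the channel with Kraus operators `K` and measure `M` on its output. -/
def pullback (M : POVM κ Ω) {R : Type} [Fintype R] (K : R → Matrix κ ι ℂ)
    (hK : ∑ r, (K r)ᴴ * K r = 1) : POVM ι Ω where
  μ := M.μ
  sigmaFinite := M.sigmaFinite
  elem z := ∑ r, (K r)ᴴ * M.elem z * K r
  measurable_elem i j := by
    simp only [Matrix.sum_apply, conjTranspose_mul_mul_apply]
    exact Finset.measurable_sum _ fun r _ => M.measurable_trace _
  posSemidef_elem z := Matrix.posSemidef_sum _ fun r _ =>
    (M.posSemidef_elem z).conjTranspose_mul_mul_same _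
  integrable_elem i j := by
    simp only [Matrix.sum_apply, conjTranspose_mul_mul_apply]
    exact integrable_finsetSum _ fun r _ => M.integrable_trace _
  integral_elem i j := by
    simp only [Matrix.sum_apply, conjTranspose_mul_mul_apply]
    rw [integral_finsetSum _ fun r _ => M.integrable_trace _, ← hK, Matrix.sum_apply]
    simp only [M.integral_trace, conjTranspose_mul_self_apply]

lemma pullback_law (M : POVM κ Ω) {R : Type} [Fintype R] (K : R → Matrix κ ι ℂ)
    (hK : ∑ r, (K r)ᴴ * K r = 1) (σ : Matrix ι ι ℂ) :
    (M.pullback K hK).law σ = M.law (krausMap K σ) := by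
  simp only [law, trace_mul_krausMap, pullback]

/-- Draw `g` uniformly from `G`, measure `M g`, and record the outcome together with `g`. -/
def uniformMixture {G : Type} [Fintype G] [Nonempty G] [MeasurableSpace G]
    [DiscreteMeasurableSpace G] (M : G → POVM ι Ω) : POVM ι (G × Ω) where
  μ := Measure.sum fun g => (Fintype.card G : NNReal)⁻¹ • (M g).μ.map (Prod.mk g)
  sigmaFinite := by
    have := fun g => (M g).sigmaFinite
    have := fun g => (measurableEmbedding_prodMk_left (β := Ω) g).sigmaFinite_map (μ := (M g).μ)
    infer_instance
  elem p := (M p.1).elem p.2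
  measurable_elem i j := measurable_from_prod_countable_right fun g => (M g).measurable_elem i j
  posSemidef_elem p := (M p.1).posSemidef_elem p.2
  integrable_elem i j := integrable_sum_map_prodMk fun g => (M g).integrable_elem i j
  integral_elem i j := by
    rw [integral_sum_map_prodMk fun g => (M g).integrable_elem i j]
    simp [(M _).integral_elem, NNReal.smul_def]

lemma uniformMixture_law_apply {G : Type} [Fintype G] [Nonempty G] [MeasurableSpace G]
    [DiscreteMeasurableSpace G] (M : G → POVM ι Ω) (σ : Matrix ι ι ℂ) {S : Set (G × Ω)}
    (hS : MeasurableSet S) :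
    (uniformMixture M).law σ S =
      (Fintype.card G : ENNReal)⁻¹ * ∑ g, (M g).law σ (Prod.mk g ⁻¹' S) := by
  have hdensity : Measurable fun p : G × Ω => ENNReal.ofReal ((M p.1).elem p.2 * σ).trace.re :=
    (uniformMixture M).measurable_density σ
  have hg : ∀ g, ∫⁻ p in S, ENNReal.ofReal ((M p.1).elem p.2 * σ).trace.re
      ∂(M g).μ.map (Prod.mk g) = (M g).law σ (Prod.mk g ⁻¹' S) := fun g => by
    rw [law_apply _ _ (measurable_prodMk_left hS), setLIntegral_map hS hdensity
      measurable_prodMk_left]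
  have hcard : (Fintype.card G : NNReal) ≠ 0 := by simp
  rw [law_apply _ _ hS]
  simp only [uniformMixture, Measure.restrict_sum _ hS, lintegral_sum_measure,
    Measure.restrict_smul, lintegral_smul_measure, hg, tsum_fintype, ← Finset.smul_sum]
  rw [ENNReal.smul_def, ENNReal.coe_inv hcard, ENNReal.coe_natCast, smul_eq_mul]

lemma le_uniformMixture_law {G : Type} [Fintype G] [Nonempty G] [MeasurableSpace G]
    [DiscreteMeasurableSpace G] (M : G → POVM ι Ω) (σ : Matrix ι ι ℂ) {S : Set (G × Ω)}
    (hS : MeasurableSet S) {p q : ℝ} (hp : 0 ≤ p) {T : Finset G}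
    (hT : q * Fintype.card G ≤ T.card)
    (hTS : ∀ g ∈ T, ENNReal.ofReal p ≤ (M g).law σ (Prod.mk g ⁻¹' S)) :
    ENNReal.ofReal (p * q) ≤ (uniformMixture M).law σ S := by
  have hcard : (Fintype.card G : ENNReal) ≠ 0 := by simp
  have hq : ENNReal.ofReal q ≤ (Fintype.card G : ENNReal)⁻¹ * T.card := by
    rw [← ENNReal.div_eq_inv_mul, ENNReal.le_div_iff_mul_le (.inl hcard) (.inl (by simp)),
      ← ENNReal.ofReal_natCast, ← ENNReal.ofReal_natCast, ← ENNReal.ofReal_mul' (by positivity)]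
    exact ENNReal.ofReal_le_ofReal hT
  calc ENNReal.ofReal (p * q) = ENNReal.ofReal q * ENNReal.ofReal p := by
        rw [ENNReal.ofReal_mul hp, mul_comm]
    _ ≤ (Fintype.card G : ENNReal)⁻¹ * T.card * ENNReal.ofReal p := by gcongr
    _ = (Fintype.card G : ENNReal)⁻¹ * ∑ g ∈ T, ENNReal.ofReal p := by
        rw [Finset.sum_const, nsmul_eq_mul, mul_assoc]
    _ ≤ (Fintype.card G : ENNReal)⁻¹ * ∑ g, (M g).law σ (Prod.mk g ⁻¹' S) := by
        gcongr
        exact (Finset.sum_le_sum hTS).trans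
          (Finset.sum_le_sum_of_subset (Finset.subset_univ T))
    _ = (uniformMixture M).law σ S := (uniformMixture_law_apply M σ hS).symm

/-- Measure `M` separately on each of the registers indexed by `J`. -/
def pi (M : POVM ι Ω) (J : Type) [Fintype J] [DecidableEq J] : POVM (J → ι) (J → Ω) where
  μ := Measure.pi fun _ => M.μ
  sigmaFinite := by
    have := M.sigmaFinite
    infer_instance
  elem z := tensorMat fun i => M.elem (z i)
  measurable_elem x y := Finset.measurable_prod _ fun i _ =>
    (M.measurable_elem (x i) (y i)).comp (measurable_pi_apply i)
  posSemidef_elem z := posSemidef_tensorMat fun i => M.posSemidef_elem (z i)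
  integrable_elem x y := by
    have := M.sigmaFinite
    exact Integrable.fintype_prod (f := fun i z => M.elem z (x i) (y i))
      fun i => M.integrable_elem (x i) (y i)
  integral_elem x y := by
    have := M.sigmaFinite
    simp only [tensorMat, Matrix.of_apply]
    rw [integral_fintype_prod_eq_prod (f := fun i z => M.elem z (x i) (y i))]
    simp only [M.integral_elem]
    rw [← tensorMat_one]
    rfl

lemma trace_pi_elem_mul (M : POVM ι Ω) (J : Type) [Fintype J] [DecidableEq J] {σ : Matrix ι ι ℂ}
    (hσ : σ.PosSemidef) (z : J → Ω) :
    ENNReal.ofReal ((M.pi J).elem z * tensorMat fun _ : J => σ).trace.re =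
      ∏ i, ENNReal.ofReal (M.elem (z i) * σ).trace.re := by
  have htrace : ((M.pi J).elem z * tensorMat fun _ : J => σ).trace =
      ((∏ i, (M.elem (z i) * σ).trace.re : ℝ) : ℂ) := by
    simp only [pi, tensorMat_mul, trace_tensorMat, Complex.ofReal_prod,
      ofReal_re_trace_mul (M.posSemidef_elem _) hσ]
  rw [htrace, Complex.ofReal_re, ENNReal.ofReal_prod_of_nonneg fun i _ =>
    re_trace_mul_nonneg (M.posSemidef_elem (z i)) hσ]

lemma pi_law (M : POVM ι Ω) (J : Type) [Fintype J] [DecidableEq J] {σ : Matrix ι ι ℂ}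
    (hσ : IsState σ) :
    (M.pi J).law (tensorMat fun _ : J => σ) = Measure.pi fun _ : J => M.law σ := by
  have := M.sigmaFinite
  have hint : Integrable (fun z => (M.elem z * σ).trace.re) M.μ := (M.integrable_trace σ).re
  have hnonneg : ∀ z, 0 ≤ (M.elem z * σ).trace.re := fun z =>
    re_trace_mul_nonneg (M.posSemidef_elem z) hσ.1
  rw [POVM.law, POVM.law, ← withDensity_pi_ofReal hnonneg hint]
  simp only [trace_pi_elem_mul M J hσ.1]
  rfl

/-- Relabel the basis of the measured space. -/
def reindex (M : POVM ι Ω) (e : κ ≃ ι) : POVM κ Ω where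
  μ := M.μ
  sigmaFinite := M.sigmaFinite
  elem z := (M.elem z).submatrix e e
  measurable_elem i j := M.measurable_elem (e i) (e j)
  posSemidef_elem z := (M.posSemidef_elem z).submatrix e
  integrable_elem i j := M.integrable_elem (e i) (e j)
  integral_elem i j := by
    simp only [Matrix.submatrix_apply, M.integral_elem, Matrix.one_apply, e.injective.eq_iff]

lemma reindex_law (M : POVM ι Ω) (e : κ ≃ ι) (σ : Matrix ι ι ℂ) :
    (M.reindex e).law (σ.submatrix e e) = M.law σ := by
  simp only [law, reindex, Matrix.submatrix_mul_equiv, trace_submatrix_equiv]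

end POVM

instance {d n : ℕ} (A : Algorithm d n) : MeasurableSpace A.Ω := A.mΩ

lemma exists_algorithm_of_channels {d k f : ℕ} (A : Algorithm k f) {η p ε q s : ℝ} (hp : 0 ≤ p)
    (hs : 0 ≤ s) (hA : A.Solves η p) {G R : Type} [Fintype G] [Nonempty G] [Fintype R]
    (K : G → R → Matrix (Fin k) (Fin d) ℂ) (hK : ∀ g, ∑ r, (K g r)ᴴ * K g r = 1)
    (Q : G → Matrix (Fin d) (Fin d) ℂ → Matrix (Fin k) (Fin k) ℂ)
    (hQ : ∀ g O, O.IsHermitian → (Q g O).IsHermitian)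
    (hgood : ∀ ρ, IsState ρ → ∀ O : Matrix (Fin d) (Fin d) ℂ, O.IsHermitian →
      ∃ T : Finset G, q * Fintype.card G ≤ T.card ∧ ∀ g ∈ T,
        |(O * ρ).trace.re - s * (Q g O * krausMap (K g) ρ).trace.re| +
          s * (η * opNorm (Q g O)) ≤ ε * opNorm O) :
    ∃ B : Algorithm d f, B.Solves ε (p * q) := by
  let _ : MeasurableSpace G := ⊤
  have : DiscreteMeasurableSpace G := ⟨fun _ => trivial⟩
  let M : POVM (Fin f → Fin d) (G × A.Ω) := POVM.uniformMixture fun g =>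
    A.povm.pullback (fun r : Fin f → R => tensorMat fun i => K g (r i))
      (sum_tensorMat_conjTranspose_mul_self (hK g))
  have hmeas : ∀ O : Matrix (Fin d) (Fin d) ℂ, O.IsHermitian →
      Measurable fun z : G × A.Ω => s * A.estimate (Q z.1 O) z.2 := fun O hO =>
    measurable_from_prod_countable_right fun g =>
      (A.measurable_estimate _ (hQ g O hO)).const_mul s
  refine ⟨⟨G × A.Ω, inferInstance, M, fun O z => s * A.estimate (Q z.1 O) z.2, hmeas⟩,
    fun ρ hρ O hO => ?_⟩
  obtain ⟨T, hT, hTg⟩ := hgood ρ hρ O hO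
  let S : Set (G × A.Ω) := {z | |(O * ρ).trace.re - s * A.estimate (Q z.1 O) z.2| ≤ ε * opNorm O}
  have hS : MeasurableSet S :=
    measurableSet_le (measurable_const.sub (hmeas O hO)).abs measurable_const
  refine POVM.le_uniformMixture_law _ _ hS hp hT fun g hg => ?_
  rw [POVM.pullback_law, tensorPower_eq_tensorMat, krausMap_tensorMat]
  refine (hA _ (isState_krausMap (hK g) hρ) (Q g O) (hQ g O hO)).trans
    (measure_mono fun z hz => ?_)
  have hscaled := mul_le_mul_of_nonneg_left hz hs
  rw [← abs_of_nonneg hs, ← abs_mul, abs_of_nonneg hs, mul_sub] at hscaled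
  exact (abs_sub_le _ _ _).trans ((add_le_add_right hscaled _).trans (hTg g hg))

section Median

variable {J : Type*} [Fintype J]

lemma nonempty_of_card_lt_two_mul {S : Finset J} (hS : Fintype.card J < 2 * S.card) :
    S.Nonempty := by
  rw [← Finset.card_pos]
  omega

variable [Nonempty J]

instance : Nonempty {S : Finset J // Fintype.card J < 2 * S.card} :=
  ⟨⟨Finset.univ, by
    have := Fintype.card_pos (α := J)
    rw [Finset.card_univ]
    omega⟩⟩

/-- The median of a finite family, encoded as the least of the maxima over all majorities. -/
def median (v : J → ℝ) : ℝ :=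
  Finset.univ.inf' Finset.univ_nonempty
    fun S : {S : Finset J // Fintype.card J < 2 * S.card} =>
      S.1.sup' (nonempty_of_card_lt_two_mul S.2) v

lemma measurable_median : Measurable (median (J := J)) := by
  have hmax (S : {S : Finset J // Fintype.card J < 2 * S.card}) :
      Measurable fun v : J → ℝ => S.1.sup' (nonempty_of_card_lt_two_mul S.2) v := by
    have hfun : (fun v : J → ℝ => S.1.sup' (nonempty_of_card_lt_two_mul S.2) v) =
        S.1.sup' (nonempty_of_card_lt_two_mul S.2) fun i v => v i :=
      funext fun v =>
        (Finset.sup'_apply (nonempty_of_card_lt_two_mul S.2) (fun i (v : J → ℝ) => v i) v).symm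
    rw [hfun]
    exact Finset.measurable_sup' _ fun i _ => measurable_pi_apply i
  have hmin : median (J := J) = Finset.univ.inf' Finset.univ_nonempty
      fun (S : {S : Finset J // Fintype.card J < 2 * S.card}) v =>
        S.1.sup' (nonempty_of_card_lt_two_mul S.2) v := by
    funext v
    simp only [median, Finset.inf'_apply]
  rw [hmin]
  exact Finset.inf'_induction _ _ (fun _ hf _ hg => hf.inf hg) fun S _ => hmax S

lemma abs_sub_median_le {v : J → ℝ} {x r : ℝ}
    (h : Fintype.card J < 2 * (Finset.univ.filter fun i => |x - v i| ≤ r).card) :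
    |x - median v| ≤ r := by
  classical
  set T := Finset.univ.filter fun i => |x - v i| ≤ r
  have hT : ∀ i ∈ T, |x - v i| ≤ r := fun i hi => (Finset.mem_filter.mp hi).2
  have upper : median v ≤ x + r := by
    refine (Finset.inf'_le _ (Finset.mem_univ ⟨T, h⟩)).trans (Finset.sup'_le _ _ fun i hi => ?_)
    linarith [(abs_le.mp (hT i hi)).1]
  have lower : x - r ≤ median v := by
    refine Finset.le_inf' _ _ fun S _ => ?_
    obtain ⟨i, hi⟩ : (S.1 ∩ T).Nonempty := by
      rw [← Finset.card_pos]
      have hinter := Finset.card_union_add_card_inter S.1 T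
      have hunion := (S.1 ∪ T).card_le_univ
      have hS := S.2
      omega
    rw [Finset.mem_inter] at hi
    have hvi : x - r ≤ v i := by linarith [(abs_le.mp (hT i hi.2)).2]
    exact hvi.trans (Finset.le_sup' v hi.1)
  rw [abs_le]
  constructor <;> linarith

end Median

open ProbabilityTheory in
lemma measure_pi_le_sum_sub_integral_le {Ω J : Type*} [MeasurableSpace Ω] [Fintype J]
    (μ : Measure Ω) [IsProbabilityMeasure μ] {F : Ω → ℝ} (hF : Measurable F)
    (hF01 : ∀ ω, F ω ∈ Set.Icc (0 : ℝ) 1) {t : ℝ} (ht : 0 ≤ t) :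
    (Measure.pi fun _ : J => μ).real
        {z | Fintype.card J * t ≤ ∑ i, (F (z i) - ∫ ω, F ω ∂μ)} ≤
      Real.exp (-(2 * t ^ 2 * Fintype.card J)) := by
  let X : J → (J → Ω) → ℝ := fun i z => F (z i) - ∫ ω, F ω ∂μ
  have hsubG : ∀ i ∈ Finset.univ,
      HasSubgaussianMGF (X i) ((‖(1 : ℝ) - 0‖₊ / 2) ^ 2) (Measure.pi fun _ : J => μ) := by
    intro i _
    have hoeffding := hasSubgaussianMGF_of_mem_Icc (μ := Measure.pi fun _ : J => μ)
      (X := fun z => F (z i)) (hF.comp (measurable_pi_apply i)).aemeasurable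
      (.of_forall fun z => hF01 (z i))
    rwa [integral_comp_eval hF.aestronglyMeasurable] at hoeffding
  have hindep : iIndepFun X (Measure.pi fun _ : J => μ) :=
    iIndepFun_pi (X := fun _ ω => F ω - ∫ ω, F ω ∂μ) fun _ => (hF.sub_const _).aemeasurable
  have hvariance : ((∑ _i : J, (‖(1 : ℝ) - 0‖₊ / 2) ^ 2 : NNReal) : ℝ) = Fintype.card J / 4 := by
    simp
    ring
  refine (HasSubgaussianMGF.measure_sum_ge_le_of_iIndepFun hindep hsubG
    (mul_nonneg (Nat.cast_nonneg' _) ht)).trans_eq ?_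
  rcases isEmpty_or_nonempty J with _ | _
  · simp
  · have hcard : (Fintype.card J : ℝ) ≠ 0 := by simp
    congr 1
    rw [hvariance]
    field_simp
    ring

lemma measure_pi_not_majority_le {Ω J : Type*} [MeasurableSpace Ω] [Fintype J] (μ : Measure Ω)
    [IsProbabilityMeasure μ] {S : Set Ω} [DecidablePred (· ∈ S)] (hS : MeasurableSet S) {p : ℝ}
    (hp : 1 / 2 ≤ p) (hμS : p ≤ μ.real S) :
    (Measure.pi fun _ : J => μ).real
        {z | 2 * (Finset.univ.filter fun i => z i ∈ S).card ≤ Fintype.card J} ≤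
      Real.exp (-(2 * (p - 1 / 2) ^ 2 * Fintype.card J)) := by
  have hmem : ∀ ω, Sᶜ.indicator (1 : Ω → ℝ) ω ∈ Set.Icc (0 : ℝ) 1 := fun ω =>
    ⟨Set.indicator_nonneg (by simp) ω, Set.indicator_le_self' (by simp) ω⟩
  refine (measureReal_mono fun z hz => ?_).trans (measure_pi_le_sum_sub_integral_le μ
    (measurable_one.indicator hS.compl) hmem (sub_nonneg.mpr hp))
  set N : ℝ := (Fintype.card J : ℝ)
  have hindicator : ∀ ω, Sᶜ.indicator (1 : Ω → ℝ) ω = 1 - if ω ∈ S then 1 else 0 := fun ω => by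
    by_cases hω : ω ∈ S <;> simp [hω]
  have hsum : ∑ i, (Sᶜ.indicator (1 : Ω → ℝ) (z i) - ∫ ω, Sᶜ.indicator 1 ω ∂μ) =
      N - (Finset.univ.filter fun i => z i ∈ S).card - N * (1 - μ.real S) := by
    rw [integral_indicator_one hS.compl, probReal_compl_eq_one_sub hS]
    simp [hindicator, Finset.sum_sub_distrib, N]
    ring
  have hz' : 2 * ((Finset.univ.filter fun i => z i ∈ S).card : ℝ) ≤ N := by
    simpa [N] using Nat.cast_le (α := ℝ).mpr hz
  rw [Set.mem_ofPred_eq, hsum]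
  nlinarith [mul_le_mul_of_nonneg_left hμS (Nat.cast_nonneg' (Fintype.card J) : 0 ≤ N)]

/-- A basis of `(ℂ^d)^{⊗ N f}`, seen as `N` groups of `f` tensor factors. -/
def groupEquiv (N f d : ℕ) : (Fin (N * f) → Fin d) ≃ (Fin N → Fin f → Fin d) :=
  (Equiv.arrowCongr finProdFinEquiv (Equiv.refl (Fin d))).symm.trans (Equiv.curry _ _ _)

lemma tensorPower_mul {d : ℕ} (N f : ℕ) (ρ : Matrix (Fin d) (Fin d) ℂ) :
    tensorPower (N * f) ρ = (tensorMat fun _ : Fin N => tensorPower f ρ).submatrix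
      (groupEquiv N f d) (groupEquiv N f d) := by
  ext x y
  simp only [tensorPower, tensorMat, Matrix.of_apply, Matrix.submatrix_apply, groupEquiv,
    Equiv.trans_apply, Equiv.curry_apply, Function.curry]
  rw [← Fintype.prod_prod_type', ← Equiv.prod_comp finProdFinEquiv]
  rfl

/-- Run an algorithm on `N` groups of `f` copies and answer with the median of the estimates. -/
def medianAlgorithm {d f : ℕ} (A : Algorithm d f) (N : ℕ) [NeZero N] : Algorithm d (N * f) where
  Ω := Fin N → A.Ω
  mΩ := inferInstance
  povm := (A.povm.pi (Fin N)).reindex (groupEquiv N f d)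
  estimate O z := median fun i => A.estimate O (z i)
  measurable_estimate O hO := measurable_median.comp (measurable_pi_lambda _ fun i =>
    (A.measurable_estimate O hO).comp (measurable_pi_apply i))

lemma medianAlgorithm_solves {d f : ℕ} {A : Algorithm d f} {ε p : ℝ} (hA : A.Solves ε p)
    (hp : 1 / 2 ≤ p) (N : ℕ) [NeZero N] :
    (medianAlgorithm A N).Solves ε (1 - Real.exp (-(2 * (p - 1 / 2) ^ 2 * N))) := by
  classical
  intro ρ hρ O hO
  set r := ε * opNorm O
  set x := (O * ρ).trace.re
  have hlaw : (medianAlgorithm A N).povm.law (tensorPower (N * f) ρ) =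
      Measure.pi fun _ : Fin N => A.povm.law (tensorPower f ρ) := by
    rw [tensorPower_mul, ← A.povm.pi_law _ (isState_tensorPower hρ)]
    exact (A.povm.pi (Fin N)).reindex_law _ _
  have := A.povm.isProbabilityMeasure_law (isState_tensorPower (n := f) hρ)
  let S : Set A.Ω := {z | |x - A.estimate O z| ≤ r}
  have hS : MeasurableSet S :=
    measurableSet_le (measurable_const.sub (A.measurable_estimate O hO)).abs measurable_const
  have hpS : p ≤ (A.povm.law (tensorPower f ρ)).real S :=
    (ENNReal.ofReal_le_iff_le_toReal (measure_ne_top _ _)).mp (hA ρ hρ O hO)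
  let E : Set (Fin N → A.Ω) := {z | |x - median fun i => A.estimate O (z i)| ≤ r}
  have hE : MeasurableSet E := measurableSet_le
    (measurable_const.sub ((medianAlgorithm A N).measurable_estimate O hO)).abs measurable_const
  have hEc : Eᶜ ⊆ {z | 2 * (Finset.univ.filter fun i => z i ∈ S).card ≤ Fintype.card (Fin N)} :=
    fun z hz => not_lt.mp fun h => hz (abs_sub_median_le h)
  have hfail := (measureReal_mono hEc).trans (measure_pi_not_majority_le _ hS hp hpS)
  rw [probReal_compl_eq_one_sub hE, Fintype.card_fin] at hfail
  calc _ ≤ ENNReal.ofReal ((Measure.pi fun _ : Fin N => A.povm.law (tensorPower f ρ)).real E) :=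
        ENNReal.ofReal_le_ofReal (by linarith)
    _ = (Measure.pi fun _ : Fin N => A.povm.law (tensorPower f ρ)) E := ofReal_measureReal
    _ = _ := by rw [hlaw]; rfl

lemma Algorithm.Solves.mono {d f : ℕ} {A : Algorithm d f} {ε p q : ℝ} (hA : A.Solves ε q)
    (hpq : p ≤ q) : A.Solves ε p :=
  fun ρ hρ O hO => (ENNReal.ofReal_le_ofReal hpq).trans (hA ρ hρ O hO)

lemma exists_algorithm_boost {d f : ℕ} {A : Algorithm d f} {ε p : ℝ} (hA : A.Solves ε p)
    (hp : 1 / 2 < p) {δ : ℝ} (hδ : 0 < δ) (hδ' : δ ≤ 1 / 2) :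
    ∃ N : ℕ, (N : ℝ) ≤ (1 / (2 * (p - 1 / 2) ^ 2) + 2) * Real.log (1 / δ) ∧
      ∃ B : Algorithm d (N * f), B.Solves ε (1 - δ) := by
  set L := Real.log (1 / δ) with hL
  set c := 2 * (p - 1 / 2) ^ 2
  have hc0 : 0 < c := by have := sub_pos.mpr hp; positivity
  have hL1 : 1 / 2 ≤ L := by
    have hlog : Real.log 2 ≤ L := Real.log_le_log two_pos (by rw [le_div_iff₀ hδ]; linarith)
    linarith [Real.log_two_gt_d9]
  set N := ⌈L / c⌉₊
  have hN : L / c ≤ N := Nat.le_ceil _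
  have : NeZero N := ⟨(Nat.ceil_pos.mpr (by positivity)).ne'⟩
  have hfail : Real.exp (-(c * N)) ≤ δ := by
    calc Real.exp (-(c * N)) ≤ Real.exp (-L) := by
          rw [Real.exp_le_exp, neg_le_neg_iff, mul_comm]
          exact (div_le_iff₀ hc0).mp hN
      _ = δ := by rw [hL, one_div, Real.log_inv, neg_neg, Real.exp_log hδ]
  refine ⟨N, ?_, medianAlgorithm A N, (medianAlgorithm_solves hA hp.le N).mono (by linarith)⟩
  calc (N : ℝ) ≤ L / c + 1 := (Nat.ceil_lt_add_one (by positivity)).le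
    _ ≤ L / c + 2 * L := by linarith
    _ = (1 / c + 2) * L := by ring

section MatrixNorms

open scoped Matrix.Norms.L2Operator Kronecker

variable {m n p q : Type*} [Fintype m] [Fintype n] [Fintype p] [Fintype q]

/-- The square of the Frobenius norm of `A`. -/
def frobSq (A : Matrix m n ℂ) : ℝ := ∑ i, ∑ j, ‖A i j‖ ^ 2

lemma frobSq_nonneg (A : Matrix m n ℂ) : 0 ≤ frobSq A :=
  Finset.sum_nonneg fun _ _ => Finset.sum_nonneg fun _ _ => sq_nonneg _

lemma frobSq_conjTranspose (A : Matrix m n ℂ) : frobSq Aᴴ = frobSq A := by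
  simp only [frobSq, Matrix.conjTranspose_apply, norm_star]
  exact Finset.sum_comm

lemma norm_mulVec_sq_le [DecidableEq n] (A : Matrix m n ℂ) (x : n → ℂ) :
    ∑ i, ‖(A *ᵥ x) i‖ ^ 2 ≤ ‖A‖ ^ 2 * ∑ j, ‖x j‖ ^ 2 := by
  have h := pow_le_pow_left₀ (norm_nonneg _) (Matrix.l2_opNorm_mulVec A (WithLp.toLp 2 x)) 2
  rwa [mul_pow, EuclideanSpace.norm_sq_eq, EuclideanSpace.norm_sq_eq] at h

lemma norm_le_of_norm_mulVec_sq_le [DecidableEq n] {A : Matrix m n ℂ} {c : ℝ} (hc : 0 ≤ c)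
    (h : ∀ x, ∑ i, ‖(A *ᵥ x) i‖ ^ 2 ≤ c ^ 2 * ∑ j, ‖x j‖ ^ 2) : ‖A‖ ≤ c := by
  refine ContinuousLinearMap.opNorm_le_bound _ hc fun x => ?_
  refine le_of_sq_le_sq ?_ (by positivity)
  rw [mul_pow, EuclideanSpace.norm_sq_eq, EuclideanSpace.norm_sq_eq]
  exact h x

lemma frobSq_mul_le [DecidableEq n] (A : Matrix m n ℂ) (B : Matrix n p ℂ) :
    frobSq (A * B) ≤ ‖A‖ ^ 2 * frobSq B := by
  rw [← frobSq_conjTranspose, ← frobSq_conjTranspose B, frobSq, frobSq, Finset.mul_sum]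
  refine Finset.sum_le_sum fun j _ => ?_
  simp only [Matrix.conjTranspose_apply, norm_star]
  exact norm_mulVec_sq_le A fun i => B i j

lemma frobSq_mul_le' [DecidableEq p] (A : Matrix m n ℂ) (B : Matrix n p ℂ) :
    frobSq (A * B) ≤ frobSq A * ‖B‖ ^ 2 := by
  classical
  rw [← frobSq_conjTranspose, Matrix.conjTranspose_mul, mul_comm (frobSq A),
    ← Matrix.l2_opNorm_conjTranspose B, ← frobSq_conjTranspose A]
  exact frobSq_mul_le _ _

lemma trace_conjTranspose_mul_self (A : Matrix m n ℂ) : (Aᴴ * A).trace = frobSq A := by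
  rw [← frobSq_conjTranspose, frobSq, Complex.ofReal_sum]
  refine Finset.sum_congr rfl fun j _ => ?_
  simp [Matrix.mul_apply, Complex.conj_mul']

lemma norm_trace_mul_conjTranspose_sq_le (A B : Matrix m n ℂ) :
    ‖(A * Bᴴ).trace‖ ^ 2 ≤ frobSq A * frobSq B := by
  have htrace : ‖(A * Bᴴ).trace‖ ≤ ∑ s : m × n, ‖A s.1 s.2‖ * ‖B s.1 s.2‖ := by
    rw [Fintype.sum_prod_type]
    refine (norm_sum_le _ _).trans (Finset.sum_le_sum fun i _ => ?_)
    rw [Matrix.diag_apply, Matrix.mul_apply]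
    refine (norm_sum_le _ _).trans_eq (Finset.sum_congr rfl fun j _ => ?_)
    rw [norm_mul, Matrix.conjTranspose_apply, norm_star]
  calc ‖(A * Bᴴ).trace‖ ^ 2
      ≤ (∑ s : m × n, ‖A s.1 s.2‖ * ‖B s.1 s.2‖) ^ 2 := by gcongr
    _ ≤ (∑ s : m × n, ‖A s.1 s.2‖ ^ 2) * ∑ s : m × n, ‖B s.1 s.2‖ ^ 2 :=
        Finset.sum_mul_sq_le_sq_mul_sq _ _ _
    _ = frobSq A * frobSq B := by simp only [frobSq, Fintype.sum_prod_type]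

lemma norm_sq_le_frobSq [DecidableEq n] (A : Matrix m n ℂ) : ‖A‖ ^ 2 ≤ frobSq A := by
  rw [← Real.le_sqrt (norm_nonneg _) (frobSq_nonneg A)]
  refine norm_le_of_norm_mulVec_sq_le (Real.sqrt_nonneg _) fun x => ?_
  rw [Real.sq_sqrt (frobSq_nonneg A), frobSq, Finset.sum_mul]
  refine Finset.sum_le_sum fun i _ => ?_
  calc ‖∑ j, A i j * x j‖ ^ 2 ≤ (∑ j, ‖A i j‖ * ‖x j‖) ^ 2 := by
        gcongr
        exact (norm_sum_le _ _).trans_eq (by simp only [norm_mul])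
    _ ≤ (∑ j, ‖A i j‖ ^ 2) * ∑ j, ‖x j‖ ^ 2 := Finset.sum_mul_sq_le_sq_mul_sq _ _ _

lemma frobSq_one_kronecker [DecidableEq m] (A : Matrix n p ℂ) :
    frobSq ((1 : Matrix m m ℂ) ⊗ₖ A) = Fintype.card m * frobSq A := by
  simp [frobSq, Fintype.sum_prod_type, Matrix.one_apply, apply_ite, ite_pow, Finset.sum_const]

lemma norm_one_kronecker_le [DecidableEq m] [DecidableEq p] (A : Matrix n p ℂ) :
    ‖(1 : Matrix m m ℂ) ⊗ₖ A‖ ≤ ‖A‖ := by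
  refine norm_le_of_norm_mulVec_sq_le (norm_nonneg _) fun x => ?_
  have hblock (a : m) (i : n) :
      (((1 : Matrix m m ℂ) ⊗ₖ A) *ᵥ x) (a, i) = (A *ᵥ fun j => x (a, j)) i := by
    simp [Matrix.mulVec, dotProduct, Fintype.sum_prod_type, Matrix.one_apply]
  simp only [Fintype.sum_prod_type, hblock, Finset.mul_sum (s := Finset.univ (α := m))]
  exact Finset.sum_le_sum fun a _ => norm_mulVec_sq_le A _

lemma norm_submatrix_equiv_le [DecidableEq n] [DecidableEq q] (A : Matrix m n ℂ) (e : p ≃ m)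
    (f : q ≃ n) : ‖A.submatrix e f‖ ≤ ‖A‖ := by
  refine norm_le_of_norm_mulVec_sq_le (norm_nonneg _) fun x => ?_
  have h := norm_mulVec_sq_le A (x ∘ f.symm)
  rw [← e.sum_comp, ← f.sum_comp] at h
  simpa [Matrix.submatrix_mulVec_equiv] using h

lemma norm_fromBlocks_offDiag_le [DecidableEq m] [DecidableEq n] (X : Matrix m n ℂ) :
    ‖Matrix.fromBlocks 0 X Xᴴ 0‖ ≤ ‖X‖ := by
  refine norm_le_of_norm_mulVec_sq_le (norm_nonneg _) fun x => ?_
  have hX := norm_mulVec_sq_le X (x ∘ Sum.inr)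
  have hXH := norm_mulVec_sq_le Xᴴ (x ∘ Sum.inl)
  rw [Matrix.l2_opNorm_conjTranspose] at hXH
  simp only [Matrix.fromBlocks_mulVec, Fintype.sum_sum_type, Sum.elim_inl, Sum.elim_inr,
    Matrix.zero_mulVec, zero_add, add_zero]
  simp only [Function.comp_apply] at hX hXH
  linarith

open scoped MatrixOrder in
lemma posSemidef_smul_one_sub_conjTranspose_mul_self [DecidableEq n] {A : Matrix m n ℂ} {c : ℝ}
    (h : ‖A‖ ^ 2 ≤ c) : ((c : ℂ) • (1 : Matrix n n ℂ) - Aᴴ * A).PosSemidef := by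
  have hA : (Aᴴ * A) ≤ ((‖A‖ ^ 2 : ℝ) : ℂ) • (1 : Matrix n n ℂ) := by
    have h := IsSelfAdjoint.le_algebraMap_norm_self (a := Aᴴ * A)
      (Matrix.isHermitian_conjTranspose_mul_self A)
    rwa [Matrix.l2_opNorm_conjTranspose_mul_self, ← sq, Algebra.algebraMap_eq_smul_one,
      ← Complex.coe_smul] at h
  have hc : ((‖A‖ ^ 2 : ℝ) : ℂ) • (1 : Matrix n n ℂ) ≤ (c : ℂ) • 1 :=
    smul_le_smul_of_nonneg_right (by exact_mod_cast h) zero_le_one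
  exact Matrix.le_iff.mp (hA.trans hc)

lemma exists_eq_conjTranspose_mul_self_of_isState {ι : Type} [Fintype ι] {ρ : Matrix ι ι ℂ}
    (hρ : IsState ρ) : ∃ B : Matrix ι ι ℂ, ρ = Bᴴ * B ∧ frobSq B = 1 := by
  obtain ⟨B, rfl⟩ := exists_eq_conjTranspose_mul_self hρ.1
  exact ⟨B, rfl, by exact_mod_cast (trace_conjTranspose_mul_self B).symm.trans hρ.2⟩

variable {ι : Type} [Fintype ι] {ρ : Matrix ι ι ℂ}

lemma IsState.norm_trace_mul_le [DecidableEq ι] (hρ : IsState ρ) (O : Matrix ι ι ℂ) :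
    ‖(O * ρ).trace‖ ≤ ‖O‖ := by
  obtain ⟨B, rfl, hB⟩ := exists_eq_conjTranspose_mul_self_of_isState hρ
  refine le_of_sq_le_sq ?_ (norm_nonneg _)
  calc ‖(O * (Bᴴ * B)).trace‖ ^ 2 = ‖(B * O * Bᴴ).trace‖ ^ 2 := by
        rw [← mul_assoc, Matrix.trace_mul_comm, ← mul_assoc]
    _ ≤ frobSq (B * O) * frobSq B := norm_trace_mul_conjTranspose_sq_le _ _
    _ ≤ ‖O‖ ^ 2 := by simpa [hB] using frobSq_mul_le' B O

lemma IsState.norm_le_one [DecidableEq ι] (hρ : IsState ρ) : ‖ρ‖ ≤ 1 := by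
  obtain ⟨B, rfl, hB⟩ := exists_eq_conjTranspose_mul_self_of_isState hρ
  rw [Matrix.l2_opNorm_conjTranspose_mul_self, ← sq, ← hB]
  exact norm_sq_le_frobSq B

lemma IsState.frobSq_le_one (hρ : IsState ρ) : frobSq ρ ≤ 1 := by
  classical
  obtain ⟨B, rfl, hB⟩ := exists_eq_conjTranspose_mul_self_of_isState hρ
  calc frobSq (Bᴴ * B) ≤ ‖Bᴴ‖ ^ 2 * frobSq B := frobSq_mul_le _ _
    _ ≤ 1 := by rw [Matrix.l2_opNorm_conjTranspose, hB, mul_one, ← hB]; exact norm_sq_le_frobSq B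

end MatrixNorms

section Uniform

variable {G H J : Type*} [Fintype G] [Fintype H]

open Classical in
/-- The probability of an event when `g` is uniformly distributed on `G`. -/
def prob (p : G → Prop) : ℝ := 𝔼 g, if p g then (1 : ℝ) else 0

lemma prob_lt_le_of_expect_le {X : G → ℝ} {a q : ℝ} (hX : 0 ≤ X) (ha : 0 ≤ a) (hq : 0 ≤ q)
    (h : 𝔼 g, X g ≤ q * a) : prob (fun g => a < X g) ≤ q := by
  rcases ha.eq_or_lt with rfl | ha
  · have hzero : X = 0 := (Fintype.expect_eq_zero_iff_of_nonneg hX).mp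
      (le_antisymm (by simpa using h) (Finset.expect_nonneg fun g _ => hX g))
    simpa [prob, hzero] using hq
  · refine le_of_mul_le_mul_right (le_trans ?_ h) ha
    rw [prob, Finset.expect_mul]
    refine Finset.expect_le_expect fun g _ => ?_
    split_ifs with hg
    · simpa using hg.le
    · simpa using hX g

lemma prob_mono {p q : G → Prop} (h : ∀ g, p g → q g) : prob p ≤ prob q := by
  refine Finset.expect_le_expect fun g _ => ?_
  by_cases hp : p g
  · simp [hp, h g hp]
  · simp only [hp, if_false]
    split_ifs <;> norm_num

lemma prob_or_le (p q : G → Prop) : prob (fun g => p g ∨ q g) ≤ prob p + prob q := by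
  rw [prob, prob, prob, ← Finset.expect_add_distrib]
  refine Finset.expect_le_expect fun g _ => ?_
  by_cases hp : p g <;> by_cases hq : q g <;> simp [hp, hq]

lemma prob_exists_le {T : Type*} (s : Finset T) (p : T → G → Prop) :
    prob (fun g => ∃ x ∈ s, p x g) ≤ ∑ x ∈ s, prob (p x) := by
  classical
  simp only [prob]
  rw [← Finset.expect_sum_comm]
  refine Finset.expect_le_expect fun g _ => ?_
  have hnonneg : ∀ x ∈ s, (0 : ℝ) ≤ if p x g then 1 else 0 := fun x _ => by
    split_ifs <;> norm_num
  split_ifs with h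
  · obtain ⟨x, hx, hpx⟩ := h
    exact (if_pos hpx).ge.trans (Finset.single_le_sum hnonneg hx)
  · exact Finset.sum_nonneg hnonneg

lemma exists_finset_of_le_prob [Nonempty G] {p : G → Prop} {q : ℝ} (h : q ≤ prob p) :
    ∃ T : Finset G, q * Fintype.card G ≤ T.card ∧ ∀ g ∈ T, p g := by
  classical
  refine ⟨Finset.univ.filter p, ?_, fun g hg => (Finset.mem_filter.mp hg).2⟩
  rw [prob, Finset.expect_eq_sum_div_card, Finset.card_univ,
    le_div_iff₀ (by simp [Fintype.card_pos]), Finset.sum_boole] at h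
  convert h

lemma prob_not [Nonempty G] (p : G → Prop) : prob (fun g => ¬ p g) = 1 - prob p := by
  rw [← Fintype.expect_one (ι := G), prob, prob, ← Finset.expect_sub_distrib]
  refine Finset.expect_congr rfl fun g _ => ?_
  by_cases hp : p g <;> simp [hp]

lemma prob_comp_equiv (e : G ≃ H) (p : H → Prop) : prob (fun g => p (e g)) = prob p :=
  Fintype.expect_equiv e _ _ fun _ => rfl

lemma prob_prod (p : G × H → Prop) : prob p = 𝔼 g, prob fun h => p (g, h) := by
  simp only [prob]
  rw [← Finset.univ_product_univ, Finset.expect_product]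

lemma prob_prod_le [Nonempty G] [Nonempty H] {p : G × H → Prop} {bad : G → Prop} {q : ℝ}
    (hq : 0 ≤ q) (h : ∀ g, ¬ bad g → prob (fun x => p (g, x)) ≤ q) : prob p ≤ prob bad + q := by
  rw [prob_prod, prob, ← Fintype.expect_const (ι := G) q, ← Finset.expect_add_distrib]
  refine Finset.expect_le_expect fun g _ => ?_
  split_ifs with hg
  · have hone : prob (fun x => p (g, x)) ≤ 1 :=
      (prob_mono fun _ _ => trivial).trans_eq (by simp [prob])
    linarith
  · simpa using h g hg

lemma expect_pi_prod {R : Type*} [Field R] [CharZero R] [Fintype J] [DecidableEq J]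
    (f : J → G → R) : 𝔼 ω : J → G, ∏ i, f i (ω i) = ∏ i, 𝔼 x, f i x := by
  simp only [Fintype.expect_eq_sum_div_card, Finset.prod_div_distrib, Finset.prod_const,
    Finset.card_univ, Fintype.card_fun, Nat.cast_pow, Finset.prod_univ_sum, Fintype.piFinset_univ]

lemma ofReal_expect (f : G → ℝ) : ((𝔼 g, f g : ℝ) : ℂ) = 𝔼 g, (f g : ℂ) := by
  simp [Finset.expect_eq_sum_div_card]

end Uniform

section Gaussian

variable {V : Type*} [NormedAddCommGroup V] [InnerProductSpace ℝ V] [FiniteDimensional ℝ V]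
  [MeasurableSpace V] [BorelSpace V]

open scoped Real

lemma integral_exp_neg_norm_sq_add_inner (w : V) :
    ∫ v : V, Real.exp (-‖v‖ ^ 2 + 2 * inner ℝ w v) =
      π ^ (Module.finrank ℝ V / 2 : ℝ) * Real.exp (‖w‖ ^ 2) := by
  have hsquare (v : V) : Real.exp (-‖v‖ ^ 2 + 2 * inner ℝ w v) =
      Real.exp (-1 * ‖v - w‖ ^ 2) * Real.exp (‖w‖ ^ 2) := by
    rw [norm_sub_sq_real, real_inner_comm, ← Real.exp_add]
    ring_nf
  simp only [hsquare]
  rw [integral_mul_const, integral_sub_right_eq_self fun v => Real.exp (-1 * ‖v‖ ^ 2),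
    GaussianFourier.integral_rexp_neg_mul_sq_norm one_pos, div_one]

lemma integrable_exp_neg_norm_sq_add_inner (w : V) :
    Integrable fun v : V => Real.exp (-‖v‖ ^ 2 + 2 * inner ℝ w v) := by
  refine .of_integral_ne_zero ?_
  rw [integral_exp_neg_norm_sq_add_inner]
  positivity

end Gaussian

section PhaseSums

variable {P : Type*} [Fintype P] [DecidableEq P]

open scoped Real

lemma stdAddChar_one_zmod_four : ZMod.stdAddChar (1 : ZMod 4) = Complex.I := by
  have h := ZMod.stdAddChar_coe (N := 4) 1
  simp only [Int.cast_one, Nat.cast_ofNat, mul_one] at h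
  rw [h, show 2 * (π : ℂ) * Complex.I / 4 = π / 2 * Complex.I by ring, Complex.exp_pi_div_two_mul_I]

lemma expect_zmod_four {R : Type*} [Field R] [CharZero R] (f : ℂ → R) :
    𝔼 n : ZMod 4, f (ZMod.stdAddChar n) = (f 1 + f Complex.I + f (-1) + f (-Complex.I)) / 4 := by
  have hpow (n : ℕ) : ZMod.stdAddChar (n : ZMod 4) = Complex.I ^ n := by
    rw [← stdAddChar_one_zmod_four, ← AddChar.map_nsmul_eq_pow, nsmul_one]
  have hsum : ∑ n : ZMod 4, f (ZMod.stdAddChar n) =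
      ∑ n ∈ Finset.range 4, f (ZMod.stdAddChar (n : ZMod 4)) := by
    rw [Finset.sum_range]
    exact Fintype.sum_congr _ _ fun n => congrArg (fun x => f (ZMod.stdAddChar x))
      (ZMod.natCast_zmod_val (n := 4) n).symm
  rw [Fintype.expect_eq_sum_div_card, ZMod.card, hsum]
  simp [hpow, Finset.sum_range_succ, Complex.I_pow_three]

lemma cosh_add_cosh_div_two_le (a b : ℝ) :
    (Real.cosh a + Real.cosh b) / 2 ≤ Real.exp ((a ^ 2 + b ^ 2) / 4) := by
  have hmean : (Real.cosh a + Real.cosh b) / 2 =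
      Real.cosh ((a + b) / 2) * Real.cosh ((a - b) / 2) := by
    have hadd := Real.cosh_add ((a + b) / 2) ((a - b) / 2)
    have hsub := Real.cosh_sub ((a + b) / 2) ((a - b) / 2)
    ring_nf at hadd hsub ⊢
    linarith
  calc (Real.cosh a + Real.cosh b) / 2
      ≤ Real.exp (((a + b) / 2) ^ 2 / 2) * Real.exp (((a - b) / 2) ^ 2 / 2) := by
        rw [hmean]
        gcongr <;> exact Real.cosh_le_exp_half_sq _
    _ = Real.exp ((a ^ 2 + b ^ 2) / 4) := by rw [← Real.exp_add]; ring_nf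

lemma expect_exp_re_le (c : ℂ) :
    𝔼 n : ZMod 4, Real.exp (c * ZMod.stdAddChar n).re ≤ Real.exp (‖c‖ ^ 2 / 4) := by
  rw [expect_zmod_four fun w => Real.exp (c * w).re, Complex.sq_norm, Complex.normSq_apply]
  refine le_trans (le_of_eq ?_) ((cosh_add_cosh_div_two_le c.re c.im).trans_eq (by ring_nf))
  simp only [mul_one, Complex.mul_I_re, mul_neg, Complex.neg_re, neg_neg, Real.cosh_eq]
  ring

lemma expect_exp_re_sum_le (c : P → ℂ) :
    𝔼 ω : P → ZMod 4, Real.exp (∑ p, c p * ZMod.stdAddChar (ω p)).re ≤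
      Real.exp ((∑ p, ‖c p‖ ^ 2) / 4) := by
  simp only [Complex.re_sum, Real.exp_sum, Finset.sum_div,
    expect_pi_prod fun p n => Real.exp (c p * ZMod.stdAddChar n).re]
  exact Finset.prod_le_prod (fun p _ => Finset.expect_nonneg fun n _ => Real.exp_nonneg _)
    fun p _ => expect_exp_re_le (c p)

lemma expect_exp_neg_norm_sq_add_inner_sum_le (z : P → ℂ) (y : ℂ) :
    𝔼 ω : P → ZMod 4,
        Real.exp (-‖y‖ ^ 2 + 2 * inner ℝ (∑ p, z p * ZMod.stdAddChar (ω p)) y) ≤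
      Real.exp (-(1 - ∑ p, ‖z p‖ ^ 2) * ‖y‖ ^ 2) := by
  have hinner (ω : P → ZMod 4) : 2 * inner ℝ (∑ p, z p * ZMod.stdAddChar (ω p)) y =
      (∑ p, 2 * conj y * z p * ZMod.stdAddChar (ω p)).re := by
    rw [real_inner_comm, Complex.inner]
    simp only [mul_assoc, ← Finset.mul_sum]
    rw [mul_comm (conj y), ← Complex.ofReal_ofNat, Complex.re_ofReal_mul]
  have hnorm : ∑ p, ‖2 * conj y * z p‖ ^ 2 = 4 * ‖y‖ ^ 2 * ∑ p, ‖z p‖ ^ 2 := by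
    simp only [norm_mul, RCLike.norm_conj, mul_pow, ← Finset.mul_sum]
    norm_num
  simp only [hinner, Real.exp_add, ← Finset.mul_expect]
  calc Real.exp (-‖y‖ ^ 2) * _
      ≤ Real.exp (-‖y‖ ^ 2) * Real.exp ((∑ p, ‖2 * conj y * z p‖ ^ 2) / 4) := by
        gcongr
        exact expect_exp_re_sum_le _
    _ = Real.exp (-(1 - ∑ p, ‖z p‖ ^ 2) * ‖y‖ ^ 2) := by
        rw [hnorm, ← Real.exp_add]
        ring_nf

-- Hubbard-Stratonovich: `exp ‖s‖²` is the Gaussian average of `exp (2 ⟪s, y⟫)` over `y`.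
lemma expect_exp_norm_sq_sum_le (z : P → ℂ) (hz : ∑ p, ‖z p‖ ^ 2 < 1) :
    𝔼 ω : P → ZMod 4, Real.exp (‖∑ p, z p * ZMod.stdAddChar (ω p)‖ ^ 2) ≤
      (1 - ∑ p, ‖z p‖ ^ 2)⁻¹ := by
  set S : (P → ZMod 4) → ℂ := fun ω => ∑ p, z p * ZMod.stdAddChar (ω p)
  have hpi := Real.pi_pos
  have hint (ω : P → ZMod 4) := integrable_exp_neg_norm_sq_add_inner (S ω)
  have hswap : π * 𝔼 ω, Real.exp (‖S ω‖ ^ 2) =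
      ∫ y : ℂ, 𝔼 ω, Real.exp (-‖y‖ ^ 2 + 2 * inner ℝ (S ω) y) := by
    simp only [Fintype.expect_eq_sum_div_card, integral_div,
      integral_finsetSum _ fun ω _ => hint ω, integral_exp_neg_norm_sq_add_inner,
      Complex.finrank_real_complex, Nat.cast_ofNat, div_self (two_ne_zero (α := ℝ)), Real.rpow_one]
    rw [← Finset.mul_sum, mul_div_assoc]
  have hgauss := GaussianFourier.integral_rexp_neg_mul_sq_norm (V := ℂ) (sub_pos.mpr hz)
  rw [Complex.finrank_real_complex, Nat.cast_ofNat, div_self two_ne_zero, Real.rpow_one] at hgauss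
  refine le_of_mul_le_mul_left (hswap.trans_le ?_) hpi
  rw [← div_eq_mul_inv, ← hgauss]
  refine integral_mono ?_ (.of_integral_ne_zero ?_) (expect_exp_neg_norm_sq_add_inner_sum_le z)
  · simp only [Fintype.expect_eq_sum_div_card]
    exact (integrable_finsetSum _ fun ω _ => hint ω).div_const _
  · rw [hgauss]
    exact (div_pos hpi (sub_pos.mpr hz)).ne'

lemma expect_norm_sq_sum_addChar {A S : Type*} [AddCommGroup A] [Fintype A] {s : Finset S}
    {ψ : S → AddChar A ℂ} (hψ : Set.InjOn ψ s) (c : S → ℂ) :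
    𝔼 a, ‖∑ x ∈ s, c x * ψ x a‖ ^ 2 = ∑ x ∈ s, ‖c x‖ ^ 2 := by
  classical
  have horth : ∀ x ∈ s, ∀ y ∈ s, 𝔼 a, ψ x a * conj (ψ y a) = if y = x then 1 else 0 :=
    fun x hx y hy => by
      have h := AddChar.wInner_cWeight_eq_boole (ψ y) (ψ x)
      simp only [RCLike.wInner_cWeight_eq_expect, RCLike.inner_apply] at h
      simpa only [hψ.eq_iff hy hx] using h
  apply Complex.ofReal_injective
  calc ((𝔼 a, ‖∑ x ∈ s, c x * ψ x a‖ ^ 2 : ℝ) : ℂ)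
      = 𝔼 a, ∑ x ∈ s, ∑ y ∈ s, c x * conj (c y) * (ψ x a * conj (ψ y a)) := by
        rw [ofReal_expect]
        refine Finset.expect_congr rfl fun a _ => ?_
        rw [Complex.ofReal_pow, ← Complex.mul_conj', map_sum, Finset.sum_mul_sum]
        simp only [map_mul]
        exact Finset.sum_congr rfl fun x _ => Finset.sum_congr rfl fun y _ => by ring
    _ = ∑ x ∈ s, ∑ y ∈ s, c x * conj (c y) * 𝔼 a, ψ x a * conj (ψ y a) := by
        simp only [Finset.expect_sum_comm, Finset.mul_expect]
    _ = ∑ x ∈ s, c x * conj (c x) := by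
        refine Finset.sum_congr rfl fun x hx => ?_
        rw [Finset.sum_congr rfl fun y hy => by rw [horth x hx y hy]]
        simp only [mul_ite, mul_one, mul_zero, Finset.sum_ite_eq', hx, if_true]
    _ = ((∑ x ∈ s, ‖c x‖ ^ 2 : ℝ) : ℂ) := by
        simp only [Complex.mul_conj', Complex.ofReal_sum, Complex.ofReal_pow]

end PhaseSums

section PhaseRatio

variable {P : Type*}

/-- The character `ω ↦ i ^ (ω p - ω q)` of `(ℤ/4)^P`. -/
def phaseRatio (p q : P) : AddChar (P → ZMod 4) ℂ :=
  ZMod.stdAddChar.compAddMonoidHom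
    (Pi.evalAddMonoidHom (fun _ : P => ZMod 4) p - Pi.evalAddMonoidHom (fun _ : P => ZMod 4) q)

lemma phaseRatio_apply (p q : P) (ω : P → ZMod 4) :
    phaseRatio p q ω = ZMod.stdAddChar (ω p) * conj (ZMod.stdAddChar (ω q)) := by
  rw [← AddChar.map_neg_eq_conj, ← AddChar.map_add_eq_mul, ← sub_eq_add_neg]
  rfl

lemma phaseRatio_self (p : P) : phaseRatio p p = 1 :=
  DFunLike.ext _ _ fun ω => by
    rw [phaseRatio_apply, Complex.mul_conj', AddChar.norm_apply]
    norm_num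

lemma injOn_phaseRatio {s : Set (P × P)} (hs : ∀ x ∈ s, x.1 ≠ x.2) :
    Set.InjOn (fun x : P × P => phaseRatio x.1 x.2) s := by
  classical
  rintro ⟨p, q⟩ hpq ⟨p', q'⟩ - h
  have hne : p ≠ q := hs _ hpq
  have heq (ω : P → ZMod 4) : ω p - ω q = ω p' - ω q' :=
    ZMod.injective_stdAddChar (DFunLike.congr_fun h ω)
  have hp := heq (Pi.single p 1)
  have hq := heq (Pi.single q 1)
  simp only [Pi.single_apply, if_neg hne, if_neg hne.symm, if_true] at hp hq
  have hp' : p' = p := by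
    by_contra hne
    revert hp
    simp only [if_neg hne]
    split_ifs <;> decide
  have hq' : q' = q := by
    by_contra hne
    revert hq
    simp only [if_neg hne]
    split_ifs <;> decide
  rw [hp', hq']

lemma expect_norm_sq_quadraticForm_sub_trace_le [Fintype P] [DecidableEq P] (N : Matrix P P ℂ) :
    𝔼 ω : P → ZMod 4, ‖∑ p, ∑ q, N p q * phaseRatio p q ω - N.trace‖ ^ 2 ≤ frobSq N := by
  have hsplit {M : Type} [AddCommMonoid M] (f : P × P → M) :
      ∑ p, ∑ q, f (p, q) = ∑ p, f (p, p) + ∑ x ∈ Finset.univ.offDiag, f x := by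
    rw [← Finset.sum_diag, ← Finset.sum_union (Finset.disjoint_diag_offDiag _),
      Finset.diag_union_offDiag, Finset.sum_product]
  have hoff (ω : P → ZMod 4) : ∑ p, ∑ q, N p q * phaseRatio p q ω - N.trace =
      ∑ x ∈ Finset.univ.offDiag, N x.1 x.2 * phaseRatio x.1 x.2 ω := by
    rw [hsplit fun x => N x.1 x.2 * phaseRatio x.1 x.2 ω]
    simp only [phaseRatio_self, AddChar.one_apply, mul_one]
    exact add_sub_cancel_left _ _
  simp only [hoff]
  rw [expect_norm_sq_sum_addChar
      (injOn_phaseRatio fun x hx => (Finset.mem_offDiag.mp hx).2.2) fun x => N x.1 x.2,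
    frobSq, hsplit fun x => ‖N x.1 x.2‖ ^ 2]
  exact le_add_of_nonneg_left (Finset.sum_nonneg fun _ _ => sq_nonneg _)

end PhaseRatio

section PhaseMatrix

open scoped Kronecker

variable {κ ι : Type*}

/-- The matrix whose entries are the fourth roots of unity with exponents `g`; for uniformly
distributed `g` it plays the role of a Gaussian matrix. -/
def phaseMatrix (g : κ × ι → ZMod 4) : Matrix κ ι ℂ :=
  Matrix.of fun a i => ZMod.stdAddChar (g (a, i))

variable [Fintype κ] [DecidableEq κ] [Fintype ι]

lemma trace_phaseMatrix_mul_mul_conjTranspose (g : κ × ι → ZMod 4) (M : Matrix ι ι ℂ) :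
    (phaseMatrix g * M * (phaseMatrix g)ᴴ).trace =
      ∑ s, ∑ t, ((1 : Matrix κ κ ℂ) ⊗ₖ M) s t * phaseRatio s t g := by
  simp only [phaseRatio_apply, Fintype.sum_prod_type, Matrix.kroneckerMap_apply, Matrix.one_apply,
    ite_mul, one_mul, zero_mul, Finset.sum_ite_irrel, Finset.sum_const_zero, Finset.sum_ite_eq,
    Finset.mem_univ, if_true]
  refine Finset.sum_congr rfl fun a _ => ?_
  rw [Matrix.diag_apply, Matrix.mul_apply]
  simp only [Matrix.mul_apply, Finset.sum_mul, Matrix.conjTranspose_apply]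
  rw [Finset.sum_comm]
  exact Finset.sum_congr rfl fun p _ => Finset.sum_congr rfl fun q _ => by
    simp only [phaseMatrix, Matrix.of_apply, RCLike.star_def]
    ring

variable [DecidableEq ι]

lemma expect_norm_sq_trace_phaseMatrix_le (M : Matrix ι ι ℂ) :
    𝔼 g : κ × ι → ZMod 4,
      ‖(phaseMatrix g * M * (phaseMatrix g)ᴴ).trace - Fintype.card κ * M.trace‖ ^ 2 ≤
        Fintype.card κ * frobSq M := by
  have h := expect_norm_sq_quadraticForm_sub_trace_le ((1 : Matrix κ κ ℂ) ⊗ₖ M)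
  rw [Matrix.trace_kronecker, Matrix.trace_one, frobSq_one_kronecker] at h
  simpa only [trace_phaseMatrix_mul_mul_conjTranspose] using h

lemma expect_exp_norm_sq_phaseMatrix_mulVec_le {z : ι → ℂ} (hz : ∑ i, ‖z i‖ ^ 2 < 1) :
    𝔼 g : κ × ι → ZMod 4, Real.exp (∑ a, ‖(phaseMatrix g *ᵥ z) a‖ ^ 2) ≤
      ((1 - ∑ i, ‖z i‖ ^ 2)⁻¹) ^ Fintype.card κ := by
  have hrow (g : κ × ι → ZMod 4) : Real.exp (∑ a, ‖(phaseMatrix g *ᵥ z) a‖ ^ 2) =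
      ∏ a, Real.exp (‖∑ i, z i * ZMod.stdAddChar (Equiv.curry κ ι _ g a i)‖ ^ 2) := by
    rw [Real.exp_sum]
    simp only [Matrix.mulVec, dotProduct, phaseMatrix, Matrix.of_apply, mul_comm,
      Equiv.curry_apply, Function.curry]
  simp only [hrow]
  rw [Fintype.expect_equiv (Equiv.curry κ ι (ZMod 4)) _
      (fun ω => ∏ a, Real.exp (‖∑ i, z i * ZMod.stdAddChar (ω a i)‖ ^ 2)) fun _ => rfl,
    expect_pi_prod (J := κ) fun _ (ω : ι → ZMod 4) =>
      Real.exp (‖∑ i, z i * ZMod.stdAddChar (ω i)‖ ^ 2),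
    Finset.prod_const, Finset.card_univ]
  exact pow_le_pow_left₀ (Finset.expect_nonneg fun _ _ => Real.exp_nonneg _)
    (expect_exp_norm_sq_sum_le z hz) _

end PhaseMatrix

section Nets

open scoped NNReal

variable {E : Type*} [NormedAddCommGroup E] [NormedSpace ℝ E] [FiniteDimensional ℝ E]

lemma card_le_of_isSeparated {η : ℝ≥0} (hη : 0 < η) {s : Finset E}
    (hs : (s : Set E) ⊆ Metric.closedBall 0 1) (hsep : Metric.IsSeparated η (s : Set E)) :
    (s.card : ℝ) ≤ (1 + 2 / η) ^ Module.finrank ℝ E := by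
  borelize E
  let ν : Measure E := Measure.addHaar
  have hη' : (0 : ℝ) < η := hη
  have hdisj : (s : Set E).PairwiseDisjoint fun x => Metric.ball x (η / 2 : ℝ) := by
    intro x hx y hy hxy
    have hlt : (η : ℝ) < dist x y := by
      rw [← ENNReal.ofReal_lt_ofReal_iff_of_nonneg hη'.le, ← edist_dist, ENNReal.ofReal_coe_nnreal]
      exact hsep hx hy hxy
    exact Metric.ball_disjoint_ball (by linarith)
  have hsub : ⋃ x ∈ s, Metric.ball x (η / 2 : ℝ) ⊆ Metric.ball 0 (1 + η / 2 : ℝ) := by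
    refine Set.iUnion₂_subset fun x hx => Metric.ball_subset_ball' ?_
    linarith [Metric.mem_closedBall.mp (hs hx)]
  have hvol : s.card * (η / 2 : ℝ) ^ Module.finrank ℝ E * ν.real (Metric.ball 0 1) ≤
      (1 + η / 2 : ℝ) ^ Module.finrank ℝ E * ν.real (Metric.ball 0 1) := by
    have hball (x : E) {r : ℝ} (hr : 0 < r) : ν.real (Metric.ball x r) =
        r ^ Module.finrank ℝ E * ν.real (Metric.ball 0 1) := by
      rw [measureReal_def, ν.addHaar_ball_of_pos x hr, ENNReal.toReal_mul,
        ENNReal.toReal_ofReal (by positivity), measureReal_def]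
    have h := measureReal_mono hsub (μ := ν) measure_ball_lt_top.ne
    rw [measureReal_biUnion_finset hdisj (fun _ _ => measurableSet_ball)
      (fun _ _ => measure_ball_lt_top.ne), hball 0 (by positivity)] at h
    simpa only [hball _ (half_pos hη'), Finset.sum_const, nsmul_eq_mul, mul_assoc] using h
  have hpos : 0 < ν.real (Metric.ball 0 1) :=
    ENNReal.toReal_pos (Metric.measure_ball_pos ν 0 one_pos).ne' measure_ball_lt_top.ne
  rw [show (1 + 2 / η : ℝ) = (1 + η / 2) / (η / 2) by field_simp; ring, div_pow,
    le_div_iff₀ (by positivity)]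
  exact le_of_mul_le_mul_right hvol hpos

variable (E) in
lemma exists_finset_net_sphere {η : ℝ≥0} (hη : 0 < η) :
    ∃ T : Finset E, (T.card : ℝ) ≤ (1 + 2 / η) ^ Module.finrank ℝ E ∧ (∀ x ∈ T, ‖x‖ = 1) ∧
      ∀ x : E, ‖x‖ = 1 → ∃ y ∈ T, ‖x - y‖ ≤ η := by
  have hfin : Metric.packingNumber η (Metric.sphere (0 : E) 1) ≠ ⊤ := by
    obtain ⟨N, -, hN, hcover⟩ := Metric.exists_finite_isCover_of_isCompact (half_pos hη).ne'
      (isCompact_sphere (0 : E) 1)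
    have h := (Metric.packingNumber_two_mul_le_externalCoveringNumber (η / 2)
      (Metric.sphere (0 : E) 1)).trans hcover.externalCoveringNumber_le_encard
    rw [mul_div_cancel₀ η two_ne_zero] at h
    exact (h.trans_lt hN.encard_lt_top).ne
  have hencard := Metric.encard_maximalSeparatedSet hfin
  have hT : (Metric.maximalSeparatedSet η (Metric.sphere (0 : E) 1)).Finite :=
    Set.encard_ne_top_iff.mp (hencard ▸ hfin)
  have hsphere : ∀ x ∈ hT.toFinset, x ∈ Metric.sphere (0 : E) 1 := fun x hx =>
    Metric.maximalSeparatedSet_subset (hT.mem_toFinset.mp hx)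
  refine ⟨hT.toFinset, card_le_of_isSeparated hη
      (fun x hx => Metric.sphere_subset_closedBall (hsphere x hx)) ?_,
    fun x hx => mem_sphere_zero_iff_norm.mp (hsphere x hx), fun x hx => ?_⟩
  · rw [hT.coe_toFinset]
    exact Metric.isSeparated_maximalSeparatedSet
  · obtain ⟨y, hy, hxy⟩ := Metric.isCover_maximalSeparatedSet hfin
      (mem_sphere_zero_iff_norm.mpr hx)
    refine ⟨y, hT.mem_toFinset.mpr hy, ?_⟩
    have hxy' : edist x y ≤ η := hxy
    rwa [edist_nndist, ENNReal.coe_le_coe, ← NNReal.coe_le_coe, coe_nndist, dist_eq_norm] at hxy'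

lemma norm_le_of_net {E F : Type*} [NormedAddCommGroup E] [NormedSpace ℂ E]
    [NormedAddCommGroup F] [NormedSpace ℂ F] (L : E →L[ℂ] F) {T : Set E} {η c : ℝ}
    (hη : 0 ≤ η) (hη' : η < 1) (hc : 0 ≤ c) (hT : ∀ x : E, ‖x‖ = 1 → ∃ y ∈ T, ‖x - y‖ ≤ η)
    (h : ∀ y ∈ T, ‖L y‖ ≤ (1 - η) * c) : ‖L‖ ≤ c := by
  have hself : ‖L‖ ≤ (1 - η) * c + ‖L‖ * η := by
    refine L.opNorm_le_of_unit_norm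
      (add_nonneg (mul_nonneg (sub_nonneg.mpr hη'.le) hc) (by positivity)) fun x hx => ?_
    obtain ⟨y, hy, hxy⟩ := hT x hx
    calc ‖L x‖ = ‖L y + L (x - y)‖ := by rw [← map_add, add_sub_cancel]
      _ ≤ ‖L y‖ + ‖L (x - y)‖ := norm_add_le _ _
      _ ≤ (1 - η) * c + ‖L‖ * η :=
        add_le_add (h y hy) (L.le_opNorm_of_le hxy)
  nlinarith

end Nets

section PhaseMatrixNorm

open scoped Matrix.Norms.L2Operator

variable {m n : Type*} [Fintype m] [Fintype n]

lemma sum_norm_sq_smul (c : ℂ) (w : n → ℂ) :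
    ∑ i, ‖(c • w) i‖ ^ 2 = ‖c‖ ^ 2 * ∑ i, ‖w i‖ ^ 2 := by
  simp only [Pi.smul_apply, norm_smul, mul_pow, Finset.mul_sum]

variable [DecidableEq n]

variable (n) in
lemma exists_finset_net_matrix :
    ∃ T : Finset (n → ℂ), T.card ≤ 441 ^ Fintype.card n ∧ (∀ x ∈ T, ∑ i, ‖x i‖ ^ 2 = 1) ∧
      ∀ (A : Matrix m n ℂ) (c : ℝ), 0 ≤ c →
        (∀ x ∈ T, ∑ i, ‖(A *ᵥ x) i‖ ^ 2 ≤ 81 / 100 * c ^ 2) → ‖A‖ ≤ c := by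
  obtain ⟨T, hcard, hsphere, hnet⟩ := exists_finset_net_sphere (EuclideanSpace ℂ n)
    (η := 1 / 10) (by norm_num)
  have hdim : Module.finrank ℝ (EuclideanSpace ℂ n) = 2 * Fintype.card n := by
    rw [← Module.finrank_mul_finrank ℝ ℂ, Complex.finrank_real_complex, finrank_euclideanSpace]
  have hnorm (x : EuclideanSpace ℂ n) : ∑ i, ‖x i‖ ^ 2 = ‖x‖ ^ 2 :=
    (EuclideanSpace.norm_sq_eq x).symm
  refine ⟨T.map (WithLp.equiv 2 (n → ℂ)).toEmbedding, ?_, ?_, fun A c hc h => ?_⟩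
  · rw [Finset.card_map]
    rw [hdim, pow_mul] at hcard
    norm_num at hcard
    exact_mod_cast hcard
  · simp only [Finset.mem_map_equiv]
    intro x hx
    rw [← one_pow 2, ← hsphere _ hx, ← hnorm]
    rfl
  · refine norm_le_of_net (Matrix.toEuclideanLin A).toContinuousLinearMap (T := T) (η := 1 / 10)
      (by norm_num) (by norm_num) hc (by simpa using hnet) fun y hy => ?_
    refine le_of_sq_le_sq ?_ (by positivity)
    rw [EuclideanSpace.norm_sq_eq]
    refine (h _ (Finset.mem_map_of_mem (WithLp.equiv 2 (n → ℂ)).toEmbedding hy)).trans_eq ?_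
    ring

variable {κ ι ν : Type*} [Fintype κ] [Fintype ι] [Fintype ν] [DecidableEq κ] [DecidableEq ι]
  [DecidableEq ν]

lemma prob_lt_norm_sq_phaseMatrix_mulVec_le (z : ι → ℂ) {c t θ : ℝ} (ht : 0 < t) (ht' : t < 1)
    (hc : 0 < c) (hz : ∑ i, ‖z i‖ ^ 2 ≤ c) :
    prob (fun g : κ × ι → ZMod 4 => θ * c < ∑ a, ‖(phaseMatrix g *ᵥ z) a‖ ^ 2) ≤
      (1 - t)⁻¹ ^ Fintype.card κ * Real.exp (-(t * θ)) := by
  have hscale : ‖(Real.sqrt (t / c) : ℂ)‖ ^ 2 = t / c := by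
    rw [Complex.norm_real, Real.norm_eq_abs, sq_abs, Real.sq_sqrt (by positivity)]
  have hz' : ∑ i, ‖((Real.sqrt (t / c) : ℂ) • z) i‖ ^ 2 ≤ t := by
    rw [sum_norm_sq_smul, hscale]
    calc t / c * ∑ i, ‖z i‖ ^ 2 ≤ t / c * c := by gcongr
      _ = t := div_mul_cancel₀ _ hc.ne'
  have hexp := (expect_exp_norm_sq_phaseMatrix_mulVec_le (κ := κ) (hz'.trans_lt ht')).trans
    (pow_le_pow_left₀ (inv_nonneg.mpr (by linarith))
      (inv_anti₀ (sub_pos.mpr ht') (sub_le_sub_left hz' 1)) (Fintype.card κ))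
  refine (prob_mono fun g hg => ?_).trans (prob_lt_le_of_expect_le (a := Real.exp (t * θ))
    (fun g => (Real.exp_pos _).le) (Real.exp_pos _).le
    (mul_nonneg (pow_nonneg (inv_nonneg.mpr (sub_nonneg.mpr ht'.le)) _) (Real.exp_pos _).le)
    (hexp.trans_eq ?_))
  · rw [Matrix.mulVec_smul, sum_norm_sq_smul, hscale, Real.exp_lt_exp]
    calc t * θ = t / c * (θ * c) := by field_simp
      _ < _ := by gcongr
  · rw [mul_assoc, ← Real.exp_add, neg_add_cancel, Real.exp_zero, mul_one]

lemma prob_lt_norm_phaseMatrix_mul_le (B : Matrix ι ν ℂ) {b t θ : ℝ} (ht : 0 < t) (ht' : t < 1)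
    (hθ : 0 ≤ θ) (hB : ‖B‖ ≤ b) :
    prob (fun g : κ × ι → ZMod 4 => θ * b ^ 2 < ‖phaseMatrix g * B‖ ^ 2) ≤
      441 ^ Fintype.card ν * ((1 - t)⁻¹ ^ Fintype.card κ * Real.exp (-(t * (81 / 100 * θ)))) := by
  have hq : 0 ≤ (1 - t)⁻¹ ^ Fintype.card κ * Real.exp (-(t * (81 / 100 * θ))) :=
    mul_nonneg (pow_nonneg (inv_nonneg.mpr (sub_nonneg.mpr ht'.le)) _) (Real.exp_pos _).le
  have hb : 0 ≤ b := (norm_nonneg B).trans hB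
  obtain ⟨T, hcard, hsphere, hnet⟩ := exists_finset_net_matrix (m := κ) ν
  have hex (g : κ × ι → ZMod 4) (hg : θ * b ^ 2 < ‖phaseMatrix g * B‖ ^ 2) :
      ∃ x ∈ T, 81 / 100 * θ * b ^ 2 < ∑ a, ‖(phaseMatrix g *ᵥ (B *ᵥ x)) a‖ ^ 2 := by
    by_contra! hle
    have hnorm := hnet (phaseMatrix g * B) (Real.sqrt θ * b) (by positivity) fun x hx => by
      rw [← Matrix.mulVec_mulVec, mul_pow, Real.sq_sqrt hθ, ← mul_assoc]
      exact hle x hx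
    have hsq := pow_le_pow_left₀ (norm_nonneg _) hnorm 2
    rw [mul_pow, Real.sq_sqrt hθ] at hsq
    exact hg.not_ge hsq
  have hx (x : ν → ℂ) (hx : x ∈ T) : prob (fun g : κ × ι → ZMod 4 =>
      81 / 100 * θ * b ^ 2 < ∑ a, ‖(phaseMatrix g *ᵥ (B *ᵥ x)) a‖ ^ 2) ≤
        (1 - t)⁻¹ ^ Fintype.card κ * Real.exp (-(t * (81 / 100 * θ))) := by
    have hBx : ∑ i, ‖(B *ᵥ x) i‖ ^ 2 ≤ b ^ 2 := by
      refine (norm_mulVec_sq_le B x).trans ?_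
      rw [hsphere x hx, mul_one]
      exact pow_le_pow_left₀ (norm_nonneg _) hB 2
    rcases hb.eq_or_lt with rfl | hb
    · have hzero : B *ᵥ x = 0 := by
        rw [norm_le_zero_iff.mp hB, Matrix.zero_mulVec]
      simpa [prob, hzero] using hq
    · exact prob_lt_norm_sq_phaseMatrix_mulVec_le _ ht ht' (by positivity) hBx
  calc _ ≤ _ := prob_mono hex
    _ ≤ _ := prob_exists_le T _
    _ ≤ _ := Finset.sum_le_card_nsmul T _ _ hx
    _ ≤ _ := by
      rw [nsmul_eq_mul]
      gcongr
      exact_mod_cast hcard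

end PhaseMatrixNorm

section Completion

variable {ι κ R : Type*} [Fintype ι] [Fintype κ] [Fintype R]

lemma exists_kraus_completion [DecidableEq ι] {K : R → Matrix κ ι ℂ}
    (hK : (1 - ∑ r, (K r)ᴴ * K r).PosSemidef) (a : κ) : ∃ L : ι → Matrix κ ι ℂ,
      ∑ r, (Sum.elim K L r)ᴴ * Sum.elim K L r = 1 ∧ ∀ Q : Matrix κ κ ℂ, Q a a = 0 → ∀ σ,
        (Q * krausMap (Sum.elim K L) σ).trace = (Q * krausMap K σ).trace := by
  classical
  obtain ⟨B, hB⟩ := exists_eq_conjTranspose_mul_self hK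
  let L (i : ι) : Matrix κ ι ℂ := Matrix.vecMulVec (Pi.single a 1) (B.row i)
  have hL (Q : Matrix κ κ ℂ) (i : ι) :
      (L i)ᴴ * Q * L i = Q a a • Matrix.vecMulVec (star (B.row i)) (B.row i) := by
    rw [Matrix.conjTranspose_vecMulVec, Matrix.vecMulVec_mul, Matrix.vecMulVec_mul_vecMulVec,
      ← Pi.single_star, star_one, Matrix.single_one_vecMul, dotProduct_single_one,
      Matrix.vecMulVec_smul, Matrix.row_apply]
  refine ⟨L, ?_, fun Q hQ σ => ?_⟩
  · have hsum : ∑ i, (L i)ᴴ * L i = Bᴴ * B := by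
      ext i j
      have hone (r : ι) := hL 1 r
      simp only [Matrix.mul_one, Matrix.one_apply_eq, one_smul] at hone
      simp only [hone, Matrix.sum_apply, Matrix.vecMulVec_apply, Matrix.mul_apply,
        Matrix.conjTranspose_apply, Pi.star_apply, Matrix.row_apply]
    rw [Fintype.sum_sum_type]
    simp only [Sum.elim_inl, Sum.elim_inr]
    rw [hsum, ← hB, add_sub_cancel]
  · rw [trace_mul_krausMap, trace_mul_krausMap, Fintype.sum_sum_type]
    simp only [Sum.elim_inl, Sum.elim_inr, hL, hQ, zero_smul, Finset.sum_const_zero, add_zero]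

end Completion

section OffDiagonal

open scoped Kronecker

variable {κ₁ κ₂ ι μ : Type*} [Fintype ι] [Fintype μ] [DecidableEq μ]

lemma sum_submatrix_mul_mul_conjTranspose (A : Matrix κ₁ (μ × ι) ℂ) (B : Matrix κ₂ (μ × ι) ℂ)
    (σ : Matrix ι ι ℂ) :
    ∑ j, A.submatrix id (Prod.mk j) * σ * (B.submatrix id (Prod.mk j))ᴴ =
      A * ((1 : Matrix μ μ ℂ) ⊗ₖ σ) * Bᴴ := by
  ext r a
  simp [Matrix.sum_apply, Matrix.mul_apply, Fintype.sum_prod_type, Matrix.one_apply]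

/-- The `μ`-indexed blocks `(V_j; W_j)` of a pair of matrices on `ℂ^μ ⊗ ℂ^ι`, rescaled by
`1 / √τ`; these are the Kraus operators of a random compression from `ℂ^ι` to `ℂ^(κ₁ ⊕ κ₂)`. -/
def blockKraus (τ : ℝ) (V : Matrix κ₁ (μ × ι) ℂ) (W : Matrix κ₂ (μ × ι) ℂ) (j : μ) :
    Matrix (κ₁ ⊕ κ₂) ι ℂ :=
  (((Real.sqrt τ)⁻¹ : ℝ) : ℂ) •
    Matrix.fromRows (V.submatrix id (Prod.mk j)) (W.submatrix id (Prod.mk j))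

/-- The observable queried after the compression: `O` transported to the off-diagonal block. Its
diagonal vanishes. -/
def offDiagQuery (V : Matrix κ₁ (μ × ι) ℂ) (W : Matrix κ₂ (μ × ι) ℂ) (O : Matrix ι ι ℂ) :
    Matrix (κ₁ ⊕ κ₂) (κ₁ ⊕ κ₂) ℂ :=
  Matrix.fromBlocks 0 (V * ((1 : Matrix μ μ ℂ) ⊗ₖ O) * Wᴴ) (V * ((1 : Matrix μ μ ℂ) ⊗ₖ O) * Wᴴ)ᴴ 0

lemma isHermitian_offDiagQuery (V : Matrix κ₁ (μ × ι) ℂ) (W : Matrix κ₂ (μ × ι) ℂ)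
    (O : Matrix ι ι ℂ) : (offDiagQuery V W O).IsHermitian :=
  Matrix.IsHermitian.fromBlocks Matrix.isHermitian_zero rfl Matrix.isHermitian_zero

lemma offDiagQuery_apply_self (V : Matrix κ₁ (μ × ι) ℂ) (W : Matrix κ₂ (μ × ι) ℂ)
    (O : Matrix ι ι ℂ) (a : κ₁ ⊕ κ₂) : offDiagQuery V W O a a = 0 := by
  cases a <;> rfl

lemma ofReal_inv_sqrt_mul_self {τ : ℝ} (hτ : 0 ≤ τ) :
    (((Real.sqrt τ)⁻¹ : ℝ) : ℂ) * ((Real.sqrt τ)⁻¹ : ℝ) = (τ⁻¹ : ℝ) := by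
  rw [← Complex.ofReal_mul, ← mul_inv, Real.mul_self_sqrt hτ]

lemma krausMap_blockKraus {τ : ℝ} (hτ : 0 ≤ τ) (V : Matrix κ₁ (μ × ι) ℂ)
    (W : Matrix κ₂ (μ × ι) ℂ) (σ : Matrix ι ι ℂ) :
    krausMap (blockKraus τ V W) σ = ((τ⁻¹ : ℝ) : ℂ) • Matrix.fromBlocks
      (V * ((1 : Matrix μ μ ℂ) ⊗ₖ σ) * Vᴴ) (V * ((1 : Matrix μ μ ℂ) ⊗ₖ σ) * Wᴴ)
      (W * ((1 : Matrix μ μ ℂ) ⊗ₖ σ) * Vᴴ) (W * ((1 : Matrix μ μ ℂ) ⊗ₖ σ) * Wᴴ) := by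
  simp only [← sum_submatrix_mul_mul_conjTranspose, krausMap, blockKraus,
    Matrix.conjTranspose_smul, Matrix.smul_mul, Matrix.mul_smul, smul_smul, RCLike.star_def,
    Complex.conj_ofReal, ofReal_inv_sqrt_mul_self hτ, ← Finset.smul_sum,
    Matrix.conjTranspose_fromRows_eq_fromCols_conjTranspose, Matrix.fromRows_mul]
  refine congrArg _ ?_
  ext (a | a) (b | b) <;> simp [Matrix.sum_apply]

variable [Fintype κ₁] [Fintype κ₂]

/-- The matrix `M` such that `tr (V M Vᴴ)` is, up to scaling, the answer to the query
`offDiagQuery V W O` on the compression of `σ`. -/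
def queryCore (W : Matrix κ₂ (μ × ι) ℂ) (O σ : Matrix ι ι ℂ) : Matrix (μ × ι) (μ × ι) ℂ :=
  ((1 : Matrix μ μ ℂ) ⊗ₖ O) * (Wᴴ * W) * ((1 : Matrix μ μ ℂ) ⊗ₖ σ)

lemma trace_fromBlocks (A : Matrix κ₁ κ₁ ℂ) (B : Matrix κ₁ κ₂ ℂ) (C : Matrix κ₂ κ₁ ℂ)
    (D : Matrix κ₂ κ₂ ℂ) : (Matrix.fromBlocks A B C D).trace = A.trace + D.trace :=
  Fintype.sum_sum_type _

lemma trace_offDiagQuery_mul_krausMap {τ : ℝ} (hτ : 0 ≤ τ) (V : Matrix κ₁ (μ × ι) ℂ)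
    (W : Matrix κ₂ (μ × ι) ℂ) {O σ : Matrix ι ι ℂ} (hσ : σ.IsHermitian) :
    (offDiagQuery V W O * krausMap (blockKraus τ V W) σ).trace.re =
      2 / τ * (V * queryCore W O σ * Vᴴ).trace.re := by
  have hσ' : ((1 : Matrix μ μ ℂ) ⊗ₖ σ)ᴴ = 1 ⊗ₖ σ := by
    rw [Matrix.conjTranspose_kronecker, Matrix.conjTranspose_one, hσ.eq]
  rw [krausMap_blockKraus hτ, offDiagQuery, Matrix.mul_smul, Matrix.fromBlocks_multiply,
    Matrix.trace_smul, trace_fromBlocks]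
  simp only [Matrix.zero_mul, zero_add, add_zero]
  set X := V * ((1 : Matrix μ μ ℂ) ⊗ₖ O) * Wᴴ with hX
  set Y := W * ((1 : Matrix μ μ ℂ) ⊗ₖ σ) * Vᴴ with hY
  have hconj : (Xᴴ * (V * ((1 : Matrix μ μ ℂ) ⊗ₖ σ) * Wᴴ)).trace = star (X * Y).trace := by
    rw [← Matrix.trace_conjTranspose, Matrix.conjTranspose_mul, Matrix.trace_mul_comm]
    simp only [hX, hY, Matrix.conjTranspose_mul, Matrix.conjTranspose_conjTranspose, hσ',
      Matrix.mul_assoc]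
  have hXY : X * Y = V * queryCore W O σ * Vᴴ := by
    simp only [hX, hY, queryCore, Matrix.mul_assoc]
  rw [hconj, hXY, smul_eq_mul, Complex.re_ofReal_mul]
  simp only [Complex.add_re, RCLike.star_def, Complex.conj_re]
  ring

end OffDiagonal

section Stack

variable {κ₁ κ₂ ι μ : Type*} [Fintype κ₁] [Fintype κ₂] [Fintype μ]

/-- The matrix `∑ j, e_j ⊗ (V_j; W_j)`, whose norm controls the Kraus operators `blockKraus`. -/
def stackMatrix (V : Matrix κ₁ (μ × ι) ℂ) (W : Matrix κ₂ (μ × ι) ℂ) :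
    Matrix (μ × (κ₁ ⊕ κ₂)) ι ℂ :=
  Matrix.of fun x => Matrix.fromRows (V.submatrix id (Prod.mk x.1)) (W.submatrix id (Prod.mk x.1))
    x.2

lemma sum_blockKraus_conjTranspose_mul_self {τ : ℝ} (hτ : 0 ≤ τ) (V : Matrix κ₁ (μ × ι) ℂ)
    (W : Matrix κ₂ (μ × ι) ℂ) : ∑ j, (blockKraus τ V W j)ᴴ * blockKraus τ V W j =
      ((τ⁻¹ : ℝ) : ℂ) • ((stackMatrix V W)ᴴ * stackMatrix V W) := by
  simp only [blockKraus, Matrix.conjTranspose_smul, Matrix.smul_mul, Matrix.mul_smul, smul_smul,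
    RCLike.star_def, Complex.conj_ofReal, ofReal_inv_sqrt_mul_self hτ, ← Finset.smul_sum]
  refine congrArg _ ?_
  ext i i'
  simp only [Matrix.sum_apply, Matrix.mul_apply, Matrix.conjTranspose_apply, stackMatrix,
    Matrix.of_apply, Fintype.sum_prod_type]

open scoped Matrix.Norms.L2Operator in
lemma posSemidef_one_sub_sum_blockKraus [Fintype ι] [DecidableEq ι] {τ : ℝ} (hτ : 0 < τ)
    {V : Matrix κ₁ (μ × ι) ℂ} {W : Matrix κ₂ (μ × ι) ℂ} (h : ‖stackMatrix V W‖ ^ 2 ≤ τ) :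
    (1 - ∑ j, (blockKraus τ V W j)ᴴ * blockKraus τ V W j).PosSemidef := by
  have hsub : 1 - ∑ j, (blockKraus τ V W j)ᴴ * blockKraus τ V W j = ((τ⁻¹ : ℝ) : ℂ) •
      ((τ : ℂ) • (1 : Matrix ι ι ℂ) - (stackMatrix V W)ᴴ * stackMatrix V W) := by
    rw [sum_blockKraus_conjTranspose_mul_self hτ.le, smul_sub, smul_smul, ← Complex.ofReal_mul,
      inv_mul_cancel₀ hτ.ne', Complex.ofReal_one, one_smul]
  rw [hsub]
  exact (posSemidef_smul_one_sub_conjTranspose_mul_self h).smul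
    (Complex.zero_le_real.mpr (inv_nonneg.mpr hτ.le))

end Stack

section Subchannels

open scoped Matrix.Norms.L2Operator

lemma opNorm_eq_norm {d : ℕ} (O : Matrix (Fin d) (Fin d) ℂ) : opNorm O = ‖O‖ := rfl

lemma exists_algorithm_of_subchannels {d k f : ℕ} (A : Algorithm k f) {η p ε q s : ℝ}
    (hp : 0 ≤ p) (hη : 0 ≤ η) (hs : 0 ≤ s) (hA : A.Solves η p) {G R κ : Type} [Fintype G]
    [Nonempty G] [Fintype R] [Fintype κ] [DecidableEq κ] (e : Fin k ≃ κ) (a : κ)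
    (K : G → R → Matrix κ (Fin d) ℂ) (hK : ∀ g, (1 - ∑ r, (K g r)ᴴ * K g r).PosSemidef)
    (Q : G → Matrix (Fin d) (Fin d) ℂ → Matrix κ κ ℂ)
    (hQ : ∀ g O, O.IsHermitian → (Q g O).IsHermitian) (hQa : ∀ g O, Q g O a a = 0)
    (hgood : ∀ ρ, IsState ρ → ∀ O : Matrix (Fin d) (Fin d) ℂ, O.IsHermitian →
      ∃ T : Finset G, q * Fintype.card G ≤ T.card ∧ ∀ g ∈ T,
        |(O * ρ).trace.re - s * (Q g O * krausMap (K g) ρ).trace.re| + s * (η * ‖Q g O‖) ≤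
          ε * ‖O‖) :
    ∃ B : Algorithm d f, B.Solves ε (p * q) := by
  choose L hL hLQ using fun g => exists_kraus_completion (hK g) a
  refine exists_algorithm_of_channels A hp hs hA
    (fun g r => (Sum.elim (K g) (L g) r).submatrix e id) (fun g => ?_)
    (fun g O => (Q g O).submatrix e e) (fun g O hO => (hQ g O hO).submatrix e)
    fun ρ hρ O hO => ?_
  · simpa only [Matrix.conjTranspose_submatrix, Matrix.submatrix_mul_equiv, Matrix.submatrix_id_id]
      using hL g
  · obtain ⟨T, hT, hTgood⟩ := hgood ρ hρ O hO
    refine ⟨T, hT, fun g hg => le_trans ?_ (hTgood g hg)⟩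
    have hmap : krausMap (fun r => (Sum.elim (K g) (L g) r).submatrix e id) ρ =
        (krausMap (Sum.elim (K g) (L g)) ρ).submatrix e e := by
      ext i j
      simp only [krausMap, Matrix.sum_apply, Matrix.submatrix_apply]
      rfl
    rw [hmap, Matrix.submatrix_mul_equiv, trace_submatrix_equiv, hLQ g _ (hQa g O), opNorm_eq_norm]
    gcongr
    exact norm_submatrix_equiv_le _ _ _

end Subchannels

section PhaseConcentration

open scoped Matrix.Norms.L2Operator

lemma conjTranspose_phaseMatrix {κ ι : Type*} (g : κ × ι → ZMod 4) :
    (phaseMatrix g)ᴴ = phaseMatrix fun x => -g x.swap := by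
  ext i a
  exact (AddChar.map_neg_eq_conj (ZMod.stdAddChar (N := 4)) (g (a, i))).symm

lemma trace_mul_conjTranspose_self {κ ν : Type*} [Fintype κ] [Fintype ν] (A : Matrix κ ν ℂ) :
    (A * Aᴴ).trace = frobSq A := by
  rw [Matrix.trace_mul_comm, trace_conjTranspose_mul_self]

variable {κ ι ν : Type*} [Fintype κ] [Fintype ι] [DecidableEq κ] [DecidableEq ι]

lemma norm_one_le : ‖(1 : Matrix ι ι ℂ)‖ ≤ 1 :=
  norm_le_of_norm_mulVec_sq_le zero_le_one fun x => by simp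

lemma prob_lt_norm_phaseMatrix_le {t θ : ℝ} (ht : 0 < t) (ht' : t < 1) (hθ : 0 ≤ θ) :
    prob (fun g : κ × ι → ZMod 4 => θ < ‖phaseMatrix g‖ ^ 2) ≤
      441 ^ Fintype.card ι * ((1 - t)⁻¹ ^ Fintype.card κ * Real.exp (-(t * (81 / 100 * θ)))) := by
  simpa using prob_lt_norm_phaseMatrix_mul_le (κ := κ) (1 : Matrix ι ι ℂ) ht ht' hθ norm_one_le

lemma prob_lt_norm_phaseMatrix_le' {t θ : ℝ} (ht : 0 < t) (ht' : t < 1) (hθ : 0 ≤ θ) :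
    prob (fun g : κ × ι → ZMod 4 => θ < ‖phaseMatrix g‖ ^ 2) ≤
      441 ^ Fintype.card κ * ((1 - t)⁻¹ ^ Fintype.card ι * Real.exp (-(t * (81 / 100 * θ)))) := by
  let e : (κ × ι → ZMod 4) ≃ (ι × κ → ZMod 4) :=
    Equiv.arrowCongr (Equiv.prodComm κ ι) (Equiv.neg (ZMod 4))
  refine Eq.trans_le ?_ (prob_lt_norm_phaseMatrix_le ht ht' hθ)
  rw [← prob_comp_equiv e]
  refine congrArg prob (funext fun g => ?_)
  rw [← Matrix.l2_opNorm_conjTranspose, conjTranspose_phaseMatrix]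
  rfl

lemma prob_lt_norm_trace_phaseMatrix_sub_le (M : Matrix ι ι ℂ) {a q : ℝ} (ha : 0 ≤ a)
    (hq : 0 ≤ q) (h : Fintype.card κ * frobSq M ≤ q * a ^ 2) :
    prob (fun g : κ × ι → ZMod 4 =>
      a < ‖(phaseMatrix g * M * (phaseMatrix g)ᴴ).trace - Fintype.card κ * M.trace‖) ≤ q :=
  (prob_mono fun _ hg => pow_lt_pow_left₀ hg ha two_ne_zero).trans <|
    prob_lt_le_of_expect_le (fun _ => sq_nonneg _) (sq_nonneg a) hq
      ((expect_norm_sq_trace_phaseMatrix_le M).trans h)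

lemma prob_lt_frobSq_phaseMatrix_mul_le [Fintype ν] [DecidableEq ν] {B : Matrix ι ν ℂ} {b : ℝ}
    (hB : frobSq B ≤ b) (hB' : ‖B‖ ≤ 1) :
    prob (fun g : κ × ι → ZMod 4 => 2 * (Fintype.card κ * b) < frobSq (phaseMatrix g * B)) ≤
      (Fintype.card κ * b)⁻¹ := by
  have hb : 0 ≤ b := (frobSq_nonneg B).trans hB
  have hBB : frobSq (B * Bᴴ) ≤ b :=
    calc frobSq (B * Bᴴ) ≤ ‖B‖ ^ 2 * frobSq Bᴴ := frobSq_mul_le _ _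
      _ ≤ 1 ^ 2 * b := by
        rw [frobSq_conjTranspose]
        gcongr
        exact frobSq_nonneg B
      _ = b := by ring
  refine (prob_mono fun g hg => ?_).trans (prob_lt_norm_trace_phaseMatrix_sub_le (B * Bᴴ)
    (a := Fintype.card κ * b) (by positivity) (by positivity) ?_)
  · have htrace : (phaseMatrix g * (B * Bᴴ) * (phaseMatrix g)ᴴ).trace =
        frobSq (phaseMatrix g * B) := by
      rw [← trace_mul_conjTranspose_self, Matrix.conjTranspose_mul]
      simp only [Matrix.mul_assoc]
    rw [htrace, trace_mul_conjTranspose_self, ← Complex.ofReal_natCast, ← Complex.ofReal_mul,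
      ← Complex.ofReal_sub, Complex.norm_real]
    refine lt_of_lt_of_le ?_ (le_abs_self _)
    nlinarith [mul_le_mul_of_nonneg_left hB (Nat.cast_nonneg (α := ℝ) (Fintype.card κ))]
  · rw [sq, ← mul_assoc, inv_mul_mul_self]
    gcongr

end PhaseConcentration

section StackPhases

variable {κ₁ κ₂ ι μ : Type*}

/-- The phases of the stacked matrix `stackMatrix V W`, given those of `W` and `V`. -/
def stackPhases : (κ₂ × μ × ι → ZMod 4) × (κ₁ × μ × ι → ZMod 4) ≃
    ((μ × (κ₁ ⊕ κ₂)) × ι → ZMod 4) where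
  toFun g x := Sum.elim (fun a => g.2 (a, x.1.1, x.2)) (fun b => g.1 (b, x.1.1, x.2)) x.1.2
  invFun h := (fun x => h ((x.2.1, Sum.inr x.1), x.2.2), fun x => h ((x.2.1, Sum.inl x.1), x.2.2))
  left_inv _ := rfl
  right_inv h := by
    ext ⟨⟨j, a | b⟩, i⟩ <;> rfl

lemma stackMatrix_phaseMatrix (g : (κ₂ × μ × ι → ZMod 4) × (κ₁ × μ × ι → ZMod 4)) :
    stackMatrix (phaseMatrix g.2) (phaseMatrix g.1) = phaseMatrix (stackPhases g) := by
  ext ⟨j, a | b⟩ i <;> rfl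

end StackPhases

section ExponentialBounds

lemma le_exp_of_pow_le {x a : ℝ} {n : ℕ} (h : x ^ 10 ≤ 2.7182 ^ n) (ha : n = 10 * a) :
    x ≤ Real.exp a := by
  refine le_of_pow_le_pow_left₀ (n := 10) (by norm_num) (Real.exp_nonneg a) (h.trans ?_)
  rw [← Real.exp_nat_mul, Nat.cast_ofNat, ← ha, ← Real.exp_one_pow]
  exact pow_le_pow_left₀ (by norm_num) (Real.exp_one_gt_d9.le.trans' (by norm_num)) n

lemma pow_mul_pow_mul_exp_neg_le {x y a b c : ℝ} {M N : ℕ} (hx : 0 ≤ x) (hy : 0 ≤ y)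
    (hxa : x ≤ Real.exp a) (hyb : y ≤ Real.exp b) (h : a * M + b * N + 199 ≤ c) :
    x ^ M * (y ^ N * Real.exp (-c)) ≤ 1 / 200 := by
  calc x ^ M * (y ^ N * Real.exp (-c))
      ≤ Real.exp a ^ M * (Real.exp b ^ N * Real.exp (-c)) := by gcongr
    _ = Real.exp (-(c - (a * M + b * N))) := by
        rw [← Real.exp_nat_mul, ← Real.exp_nat_mul, ← Real.exp_add, ← Real.exp_add]
        ring_nf
    _ ≤ 1 / 200 := by
        rw [Real.exp_neg, ← one_div]
        exact one_div_le_one_div_of_le (by norm_num) (by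
          linarith [Real.add_one_le_exp (c - (a * M + b * N))])

lemma four_hundred_forty_one_le_exp : (441 : ℝ) ≤ Real.exp 6.1 :=
  le_exp_of_pow_le (n := 61) (by norm_num) (by norm_num)

end ExponentialBounds

/-- The size conditions under which a random compression from dimension `d` to dimension
`k₁ + k₂` with `m` Kraus operators preserves expectation values to accuracy `ε`. -/
structure CompressionRegime (d k₁ k₂ m : ℕ) (ε : ℝ) : Prop where
  pos : 0 < ε
  le_right : (k₁ : ℝ) ≤ k₂
  right_le : (k₂ : ℝ) ≤ k₁ + 1
  large : (10000 : ℝ) ≤ k₁ + k₂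
  le_dim : (k₁ + k₂ : ℝ) ≤ d
  le_kraus : (8 * d : ℝ) ≤ m * (k₁ + k₂)
  kraus_le : (m * (k₁ + k₂) : ℝ) ≤ 9 * d
  dim_le : 10000 * (d : ℝ) ≤ ε ^ 2 * (k₁ + k₂) ^ 2

namespace CompressionRegime

lemma exists_of_dim_le {d k : ℕ} {ε : ℝ} (hε : 0 < ε) (hk : 10000 ≤ k) (hkd : k ≤ d)
    (hd : 10000 * (d : ℝ) ≤ ε ^ 2 * (k : ℝ) ^ 2) :
    ∃ k₁ k₂ m : ℕ, k₁ + k₂ = k ∧ CompressionRegime d k₁ k₂ m ε := by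
  have hsum : k / 2 + (k - k / 2) = k := by omega
  have hsumR : ((k / 2 : ℕ) : ℝ) + ((k - k / 2 : ℕ) : ℝ) = k := by exact_mod_cast hsum
  have hkR : (0 : ℝ) < k := by exact_mod_cast (by omega : 0 < k)
  have hkdR : (k : ℝ) ≤ d := by exact_mod_cast hkd
  have hceil : (⌈8 * (d : ℝ) / k⌉₊ : ℝ) < 8 * d / k + 1 := Nat.ceil_lt_add_one (by positivity)
  refine ⟨k / 2, k - k / 2, ⌈8 * (d : ℝ) / k⌉₊, hsum, ?_⟩
  constructor <;> try rw [hsumR]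
  · exact hε
  · exact_mod_cast (by omega : k / 2 ≤ k - k / 2)
  · exact_mod_cast (by omega : k - k / 2 ≤ k / 2 + 1)
  · exact_mod_cast hk
  · exact hkdR
  · rw [← div_le_iff₀ hkR]
    exact Nat.le_ceil _
  · calc (⌈8 * (d : ℝ) / k⌉₊ : ℝ) * k ≤ (8 * d / k + 1) * k := by gcongr
      _ = 8 * d + k := by field_simp
      _ ≤ 9 * d := by linarith
  · exact hd

lemma exists_of_sqrt_le {d k : ℕ} {ε : ℝ} (hε : 0 < ε) (hε' : ε ≤ 1) (hd : 0 < d) (hkd : k ≤ d)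
    (hk : 100 * Real.sqrt d / ε ≤ k) :
    ∃ k₁ k₂ m : ℕ, k₁ + k₂ = k ∧ CompressionRegime d k₁ k₂ m ε := by
  have hkdR : (k : ℝ) ≤ d := by exact_mod_cast hkd
  have hdim : 10000 * (d : ℝ) ≤ ε ^ 2 * (k : ℝ) ^ 2 := by
    rw [div_le_iff₀ hε] at hk
    calc 10000 * (d : ℝ) = (100 * Real.sqrt d) ^ 2 := by
          rw [mul_pow, Real.sq_sqrt (Nat.cast_nonneg d)]
          norm_num
      _ ≤ (k * ε) ^ 2 := by gcongr
      _ = ε ^ 2 * (k : ℝ) ^ 2 := by ring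
  have hkpos : (0 : ℝ) < k := hk.trans_lt' (by positivity)
  have hlarge : (10000 : ℝ) ≤ k := by
    refine le_of_mul_le_mul_right ?_ hkpos
    calc 10000 * (k : ℝ) ≤ 10000 * d := by gcongr
      _ ≤ ε ^ 2 * (k : ℝ) ^ 2 := hdim
      _ ≤ k * k := by
        rw [← sq]
        exact mul_le_of_le_one_left (sq_nonneg _) (pow_le_one₀ hε.le hε')
  exact exists_of_dim_le hε (by exact_mod_cast hlarge) hkd hdim

variable {d k₁ k₂ m : ℕ} {ε : ℝ} (h : CompressionRegime d k₁ k₂ m ε)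
include h

lemma dim_large : (10000 : ℝ) ≤ d := h.large.trans h.le_dim

lemma le_sq_mul_dim : 10000 ≤ ε ^ 2 * d := by
  refine le_of_mul_le_mul_right (h.dim_le.trans ?_) (by linarith [h.dim_large] : (0 : ℝ) < d)
  rw [mul_assoc, ← sq]
  have hkd := h.le_dim
  gcongr

lemma left_pos : (0 : ℝ) < k₁ := by linarith [h.right_le, h.large]

lemma right_pos : (0 : ℝ) < k₂ := h.left_pos.trans_le h.le_right

lemma eight_le_kraus : (8 : ℝ) ≤ m :=
  le_of_mul_le_mul_right (by linarith [h.le_kraus, h.le_dim]) (add_pos h.left_pos h.right_pos)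

lemma kraus_pos : (0 : ℝ) < m := by linarith [h.eight_le_kraus]

lemma four_mul_dim_le : 4 * (d : ℝ) ≤ k₂ * m := by
  nlinarith [h.le_kraus, h.le_right, h.kraus_pos]

lemma sq_le_mul : 9999 / 40000 * (k₁ + k₂ : ℝ) ^ 2 ≤ k₁ * k₂ := by
  have hdiff : (k₂ - k₁ : ℝ) ^ 2 ≤ 1 :=
    (sq_le_one_iff₀ (by linarith [h.le_right])).mpr (by linarith [h.right_le])
  nlinarith [h.large]

open scoped Matrix.Norms.L2Operator Kronecker

lemma prob_lt_norm_stackMatrix_le :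
    prob (fun g : (Fin k₂ × Fin m × Fin d → ZMod 4) × (Fin k₁ × Fin m × Fin d → ZMod 4) =>
      30 * (d : ℝ) < ‖stackMatrix (phaseMatrix g.2) (phaseMatrix g.1)‖ ^ 2) ≤ 1 / 200 := by
  simp only [stackMatrix_phaseMatrix]
  rw [prob_comp_equiv stackPhases fun g => 30 * (d : ℝ) < ‖phaseMatrix g‖ ^ 2]
  refine (prob_lt_norm_phaseMatrix_le (t := 2 / 3) (by norm_num) (by norm_num)
    (by positivity)).trans ?_
  refine pow_mul_pow_mul_exp_neg_le (b := 1.1) (by norm_num) (by norm_num)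
    four_hundred_forty_one_le_exp (le_exp_of_pow_le (n := 11) (by norm_num) (by norm_num)) ?_
  simp only [Fintype.card_prod, Fintype.card_sum, Fintype.card_fin]
  push_cast
  linarith [h.kraus_le, h.dim_large]

lemma prob_lt_norm_phaseMatrix_le :
    prob (fun g : Fin k₂ × Fin m × Fin d → ZMod 4 =>
      27 / 10 * (m * d : ℝ) < ‖phaseMatrix g‖ ^ 2) ≤ 1 / 200 := by
  refine (prob_lt_norm_phaseMatrix_le' (t := 1 / 2) (by norm_num) (by norm_num)
    (by positivity)).trans ?_
  refine pow_mul_pow_mul_exp_neg_le (b := 0.7) (by norm_num) (by norm_num)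
    four_hundred_forty_one_le_exp (le_exp_of_pow_le (n := 7) (by norm_num) (by norm_num)) ?_
  simp only [Fintype.card_prod, Fintype.card_fin]
  push_cast
  have hmd : (8 * d : ℝ) ≤ m * d := by gcongr; exact h.eight_le_kraus
  linarith [h.right_le, h.large, h.le_dim]

lemma prob_lt_norm_phaseMatrix_mul_le {ι : Type*} [Fintype ι] [DecidableEq ι]
    {B : Matrix ι (Fin k₂) ℂ} {b : ℝ} (hB : ‖B‖ ≤ b) :
    prob (fun g : Fin k₁ × ι → ZMod 4 =>
      29 / 5 * (k₁ + k₂ : ℝ) * b ^ 2 < ‖phaseMatrix g * B‖ ^ 2) ≤ 1 / 200 := by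
  refine (Shadows.prob_lt_norm_phaseMatrix_mul_le B (t := 8 / 9) (by norm_num) (by norm_num)
    (by positivity) hB).trans ?_
  refine pow_mul_pow_mul_exp_neg_le (b := 2.2) (by norm_num) (by norm_num)
    four_hundred_forty_one_le_exp (le_exp_of_pow_le (n := 22) (by norm_num) (by norm_num)) ?_
  simp only [Fintype.card_fin]
  linarith [h.right_le, h.large, h.le_right]

end CompressionRegime

section GoodPhases

open scoped Matrix.Norms.L2Operator Kronecker

variable {d k₁ k₂ m : ℕ} {ε : ℝ} {ρ : Matrix (Fin d) (Fin d) ℂ}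
  {W : Matrix (Fin k₂) (Fin m × Fin d) ℂ}

/-- The properties that a random lower block `W` needs for the state `ρ` and the observable `O`. -/
structure GoodLower (ε : ℝ) (ρ O : Matrix (Fin d) (Fin d) ℂ)
    (W : Matrix (Fin k₂) (Fin m × Fin d) ℂ) : Prop where
  norm_sq_le : ‖W‖ ^ 2 ≤ 27 / 10 * (m * d)
  frobSq_le : frobSq (W * ((1 : Matrix (Fin m) (Fin m) ℂ) ⊗ₖ ρ)) ≤ 2 * (k₂ * m)
  trace_le : ‖(queryCore W O ρ).trace - k₂ * (m * (O * ρ).trace)‖ ≤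
    3 / 100 * ε * (m * k₂ * ‖O‖)

/-- The properties that a random upper block `V` needs, given the lower block `W`, for the state
`ρ` and the observable `O`. -/
structure GoodUpper (ε : ℝ) (ρ O : Matrix (Fin d) (Fin d) ℂ)
    (W : Matrix (Fin k₂) (Fin m × Fin d) ℂ) (V : Matrix (Fin k₁) (Fin m × Fin d) ℂ) : Prop where
  norm_sq_le : ‖V * (((1 : Matrix (Fin m) (Fin m) ℂ) ⊗ₖ O) * Wᴴ)‖ ^ 2 ≤
    29 / 5 * (k₁ + k₂) * (‖O‖ * ‖W‖) ^ 2
  trace_le : ‖(V * queryCore W O ρ * Vᴴ).trace - k₁ * (queryCore W O ρ).trace‖ ≤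
    1 / 10 * ε * (m * k₁ * k₂ * ‖O‖)

lemma trace_queryCore {κ₂ ι μ : Type*} [Fintype κ₂] [Fintype ι] [Fintype μ] [DecidableEq μ]
    (W : Matrix κ₂ (μ × ι) ℂ) (O σ : Matrix ι ι ℂ) :
    (queryCore W O σ).trace = (W * ((1 : Matrix μ μ ℂ) ⊗ₖ (σ * O)) * Wᴴ).trace := by
  have hkron : (1 : Matrix μ μ ℂ) ⊗ₖ (σ * O) = (1 ⊗ₖ σ) * (1 ⊗ₖ O) := by
    rw [← Matrix.mul_kronecker_mul, one_mul]
  rw [queryCore, hkron, Matrix.trace_mul_comm, ← mul_assoc, Matrix.trace_mul_cycle W,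
    Matrix.trace_mul_comm]

lemma norm_one_kronecker_mul_conjTranspose_le {κ₂ ι μ : Type*} [Fintype κ₂] [Fintype ι] [Fintype μ]
    [DecidableEq κ₂] [DecidableEq ι] [DecidableEq μ] (W : Matrix κ₂ (μ × ι) ℂ) (O : Matrix ι ι ℂ) :
    ‖((1 : Matrix μ μ ℂ) ⊗ₖ O) * Wᴴ‖ ≤ ‖O‖ * ‖W‖ := by
  refine (Matrix.l2_opNorm_mul _ _).trans ?_
  rw [Matrix.l2_opNorm_conjTranspose]
  gcongr
  exact norm_one_kronecker_le O

lemma frobSq_queryCore_le {O : Matrix (Fin d) (Fin d) ℂ} (hW : GoodLower ε ρ O W) :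
    frobSq (queryCore W O ρ) ≤ 27 / 5 * (d * k₂ * (m * ‖O‖) ^ 2) :=
  calc frobSq (queryCore W O ρ)
      = frobSq ((((1 : Matrix (Fin m) (Fin m) ℂ) ⊗ₖ O) * Wᴴ) *
          (W * ((1 : Matrix (Fin m) (Fin m) ℂ) ⊗ₖ ρ))) := by
        simp only [queryCore, Matrix.mul_assoc]
    _ ≤ (‖O‖ * ‖W‖) ^ 2 * (2 * (k₂ * m)) := by
        refine (frobSq_mul_le _ _).trans ?_
        gcongr
        · exact frobSq_nonneg _
        · exact norm_one_kronecker_mul_conjTranspose_le W O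
        · exact hW.frobSq_le
    _ = ‖O‖ ^ 2 * ‖W‖ ^ 2 * (2 * (k₂ * m)) := by rw [mul_pow]
    _ ≤ ‖O‖ ^ 2 * (27 / 10 * (m * d)) * (2 * (k₂ * m)) := by
        gcongr
        exact hW.norm_sq_le
    _ = _ := by ring

namespace CompressionRegime

variable (h : CompressionRegime d k₁ k₂ m ε)
include h

lemma prob_lt_norm_trace_queryCore_sub_le (hρ : IsState ρ) (O : Matrix (Fin d) (Fin d) ℂ) :
    prob (fun g : Fin k₂ × Fin m × Fin d → ZMod 4 => 3 / 100 * ε * (m * k₂ * ‖O‖) <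
      ‖(queryCore (phaseMatrix g) O ρ).trace - k₂ * (m * (O * ρ).trace)‖) ≤ 3 / 100 := by
  have hε := h.pos
  have htrace : ((1 : Matrix (Fin m) (Fin m) ℂ) ⊗ₖ (ρ * O)).trace = m * (O * ρ).trace := by
    rw [Matrix.trace_kronecker, Matrix.trace_one, Fintype.card_fin, Matrix.trace_mul_comm]
  have hfrob : frobSq ((1 : Matrix (Fin m) (Fin m) ℂ) ⊗ₖ (ρ * O)) ≤ m * ‖O‖ ^ 2 := by
    rw [frobSq_one_kronecker, Fintype.card_fin]
    gcongr
    exact (frobSq_mul_le' _ _).trans (mul_le_of_le_one_left (sq_nonneg _) hρ.frobSq_le_one)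
  have hsize : 1 ≤ 27 / 1000000 * ε ^ 2 * (k₂ * m) := by
    nlinarith [h.le_sq_mul_dim, mul_le_mul_of_nonneg_left h.four_mul_dim_le (sq_nonneg ε)]
  have hbound := Shadows.prob_lt_norm_trace_phaseMatrix_sub_le (κ := Fin k₂)
    ((1 : Matrix (Fin m) (Fin m) ℂ) ⊗ₖ (ρ * O)) (a := 3 / 100 * ε * (m * k₂ * ‖O‖))
    (q := 3 / 100) (by positivity) (by norm_num) ?_
  · simpa only [trace_queryCore, htrace, Fintype.card_fin] using hbound
  · rw [Fintype.card_fin]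
    calc k₂ * frobSq ((1 : Matrix (Fin m) (Fin m) ℂ) ⊗ₖ (ρ * O)) ≤ k₂ * (m * ‖O‖ ^ 2) * 1 := by
          rw [mul_one]
          gcongr
      _ ≤ k₂ * (m * ‖O‖ ^ 2) * (27 / 1000000 * ε ^ 2 * (k₂ * m)) := by gcongr
      _ = 3 / 100 * (3 / 100 * ε * (m * k₂ * ‖O‖)) ^ 2 := by ring

lemma prob_not_goodLower_le (hρ : IsState ρ) (O : Matrix (Fin d) (Fin d) ℂ) :
    prob (fun g : Fin k₂ × Fin m × Fin d → ZMod 4 => ¬ GoodLower ε ρ O (phaseMatrix g)) ≤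
      1 / 25 := by
  have hfrob : frobSq ((1 : Matrix (Fin m) (Fin m) ℂ) ⊗ₖ ρ) ≤ m := by
    rw [frobSq_one_kronecker, Fintype.card_fin]
    exact mul_le_of_le_one_right (by positivity) hρ.frobSq_le_one
  have hinv : ((Fintype.card (Fin k₂) : ℝ) * m)⁻¹ ≤ 1 / 200 := by
    rw [Fintype.card_fin, ← one_div]
    exact one_div_le_one_div_of_le (by norm_num) (by linarith [h.four_mul_dim_le, h.dim_large])
  have hnorm := h.prob_lt_norm_phaseMatrix_le
  have hfrobSq := (prob_lt_frobSq_phaseMatrix_mul_le (κ := Fin k₂) hfrob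
    ((norm_one_kronecker_le ρ).trans hρ.norm_le_one)).trans hinv
  have htrace := h.prob_lt_norm_trace_queryCore_sub_le hρ O
  rw [Fintype.card_fin] at hfrobSq
  calc _ ≤ _ := prob_mono fun g hg => by
        by_contra hgood
        simp only [not_or, not_lt] at hgood
        exact hg ⟨hgood.1, hgood.2.1, hgood.2.2⟩
    _ ≤ _ := prob_or_le _ _
    _ ≤ _ := add_le_add_right (prob_or_le _ _) _
    _ ≤ 1 / 200 + (1 / 200 + 3 / 100) := add_le_add hnorm (add_le_add hfrobSq htrace)
    _ = 1 / 25 := by norm_num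

lemma prob_not_goodUpper_le {O : Matrix (Fin d) (Fin d) ℂ} (hW : GoodLower ε ρ O W) :
    prob (fun g : Fin k₁ × Fin m × Fin d → ZMod 4 => ¬ GoodUpper ε ρ O W (phaseMatrix g)) ≤
      9 / 40 := by
  have hε := h.pos
  have hnorm := h.prob_lt_norm_phaseMatrix_mul_le (norm_one_kronecker_mul_conjTranspose_le W O)
  have hsize : 27 / 5 * (d : ℝ) ≤ 11 / 5000 * ε ^ 2 * (k₁ * k₂) := by
    nlinarith [h.dim_le, mul_le_mul_of_nonneg_left h.sq_le_mul (sq_nonneg ε), h.dim_large]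
  have hfrob : k₁ * frobSq (queryCore W O ρ) ≤
      11 / 50 * (1 / 10 * ε * (m * k₁ * k₂ * ‖O‖)) ^ 2 :=
    calc k₁ * frobSq (queryCore W O ρ)
        ≤ k₁ * (27 / 5 * (d * k₂ * (m * ‖O‖) ^ 2)) := by
          gcongr
          exact frobSq_queryCore_le hW
      _ = 27 / 5 * d * (k₁ * k₂ * (m * ‖O‖) ^ 2) := by ring
      _ ≤ 11 / 5000 * ε ^ 2 * (k₁ * k₂) * (k₁ * k₂ * (m * ‖O‖) ^ 2) := by gcongr
      _ = _ := by ring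
  have htrace := prob_lt_norm_trace_phaseMatrix_sub_le (κ := Fin k₁) (queryCore W O ρ)
    (a := 1 / 10 * ε * (m * k₁ * k₂ * ‖O‖)) (q := 11 / 50) (by positivity) (by norm_num)
    (by rwa [Fintype.card_fin])
  rw [Fintype.card_fin] at htrace
  calc _ ≤ _ := prob_mono fun g hg => by
        by_contra hgood
        simp only [not_or, not_lt] at hgood
        exact hg ⟨hgood.1, hgood.2⟩
    _ ≤ _ := prob_or_le _ _
    _ ≤ 1 / 200 + 11 / 50 := add_le_add hnorm htrace
    _ = 9 / 40 := by norm_num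

lemma prob_good_ge (hρ : IsState ρ) (O : Matrix (Fin d) (Fin d) ℂ) :
    73 / 100 ≤ prob fun g : (Fin k₂ × Fin m × Fin d → ZMod 4) × (Fin k₁ × Fin m × Fin d → ZMod 4) =>
      ‖stackMatrix (phaseMatrix g.2) (phaseMatrix g.1)‖ ^ 2 ≤ 30 * (d : ℝ) ∧
        GoodLower ε ρ O (phaseMatrix g.1) ∧
          GoodUpper ε ρ O (phaseMatrix g.1) (phaseMatrix g.2) := by
  have hblocks := prob_prod_le (H := Fin k₁ × Fin m × Fin d → ZMod 4)
    (p := fun g => ¬ (GoodLower ε ρ O (phaseMatrix g.1) ∧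
      GoodUpper ε ρ O (phaseMatrix g.1) (phaseMatrix g.2)))
    (bad := fun w : Fin k₂ × Fin m × Fin d → ZMod 4 => ¬ GoodLower ε ρ O (phaseMatrix w))
    (q := 9 / 40) (by norm_num) fun w hw => by
      rw [not_not] at hw
      simpa only [hw, true_and] using h.prob_not_goodUpper_le hw
  have hor := (prob_or_le _ _).trans (add_le_add h.prob_lt_norm_stackMatrix_le hblocks)
  have hlower := h.prob_not_goodLower_le hρ O
  simp only [← not_le, ← not_and_or, prob_not] at hor hlower
  linarith

variable {O : Matrix (Fin d) (Fin d) ℂ} {V : Matrix (Fin k₁) (Fin m × Fin d) ℂ}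

lemma norm_offDiagQuery_le (hW : GoodLower ε ρ O W) (hV : GoodUpper ε ρ O W V) :
    (k₁ + k₂) * ‖offDiagQuery V W O‖ ≤ 29 / 5 * (m * k₁ * k₂ * ‖O‖) := by
  have hm := h.kraus_pos
  set k : ℝ := k₁ + k₂
  have hkpos : 0 < k := add_pos h.left_pos h.right_pos
  have hsize : 783 / 50 * (k ^ 3 * d) ≤ 841 / 25 * (m * (k₁ * k₂) ^ 2) := by
    have hkraus : 8 * d * k ^ 3 ≤ m * k * k ^ 3 :=
      mul_le_mul_of_nonneg_right h.le_kraus (by positivity)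
    have hsq : (9999 / 40000 * k ^ 2) ^ 2 ≤ (k₁ * k₂ : ℝ) ^ 2 :=
      pow_le_pow_left₀ (by positivity) h.sq_le_mul 2
    linarith [mul_le_mul_of_nonneg_left hsq hm.le, (by positivity : 0 ≤ k ^ 3 * d)]
  have hblock : ‖V * (((1 : Matrix (Fin m) (Fin m) ℂ) ⊗ₖ O)) * Wᴴ‖ ^ 2 ≤
      783 / 50 * (k * (m * d) * ‖O‖ ^ 2) := by
    rw [Matrix.mul_assoc]
    calc _ ≤ 29 / 5 * k * (‖O‖ * ‖W‖) ^ 2 := hV.norm_sq_le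
      _ = 29 / 5 * k * ‖O‖ ^ 2 * ‖W‖ ^ 2 := by ring
      _ ≤ 29 / 5 * k * ‖O‖ ^ 2 * (27 / 10 * (m * d)) := by
        gcongr
        exact hW.norm_sq_le
      _ = _ := by ring
  refine (mul_le_mul_of_nonneg_left (norm_fromBlocks_offDiag_le _) hkpos.le).trans ?_
  refine le_of_sq_le_sq ?_ (by positivity)
  calc _ ≤ k ^ 2 * (783 / 50 * (k * (m * d) * ‖O‖ ^ 2)) := by
        rw [mul_pow]
        gcongr
    _ = 783 / 50 * (k ^ 3 * d) * (m * ‖O‖ ^ 2) := by ring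
    _ ≤ 841 / 25 * (m * (k₁ * k₂) ^ 2) * (m * ‖O‖ ^ 2) := by gcongr
    _ = _ := by ring

lemma abs_trace_sub_le (hρ : IsState ρ) (hW : GoodLower ε ρ O W) (hV : GoodUpper ε ρ O W V) :
    |(O * ρ).trace.re - 15 * d / (m * k₁ * k₂) *
        (offDiagQuery V W O * krausMap (blockKraus (30 * d) V W) ρ).trace.re| ≤
      13 / 100 * ε * ‖O‖ := by
  have hd := h.dim_large
  have hpos : (0 : ℝ) < m * k₁ * k₂ := mul_pos (mul_pos h.kraus_pos h.left_pos) h.right_pos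
  set N : ℝ := m * k₁ * k₂ with hN
  have herror : ‖(V * queryCore W O ρ * Vᴴ).trace - (N : ℂ) * (O * ρ).trace‖ ≤
      13 / 100 * ε * (N * ‖O‖) := by
    have hsplit : (V * queryCore W O ρ * Vᴴ).trace - (N : ℂ) * (O * ρ).trace =
        ((V * queryCore W O ρ * Vᴴ).trace - k₁ * (queryCore W O ρ).trace) +
          k₁ * ((queryCore W O ρ).trace - k₂ * (m * (O * ρ).trace)) := by
      rw [hN]
      push_cast
      ring
    rw [hsplit]
    refine (norm_add_le _ _).trans ?_
    rw [norm_mul, Complex.norm_natCast]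
    have hleft := h.left_pos
    nlinarith [hV.trace_le, mul_le_mul_of_nonneg_left hW.trace_le hleft.le]
  rw [trace_offDiagQuery_mul_krausMap (by positivity) V W hρ.1.isHermitian]
  set T := (V * queryCore W O ρ * Vᴴ).trace
  have hquot : (O * ρ).trace.re - 15 * d / N * (2 / (30 * d) * T.re) =
      -(T - (N : ℂ) * (O * ρ).trace).re / N := by
    rw [Complex.sub_re, Complex.re_ofReal_mul]
    field_simp
    ring
  rw [hquot, abs_div, abs_neg, abs_of_pos hpos, div_le_iff₀ hpos]
  exact (Complex.abs_re_le_norm _).trans (herror.trans_eq (by ring))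

lemma query_accuracy (hρ : IsState ρ) (hW : GoodLower ε ρ O W) (hV : GoodUpper ε ρ O W V) :
    |(O * ρ).trace.re - 15 * d / (m * k₁ * k₂) *
        (offDiagQuery V W O * krausMap (blockKraus (30 * d) V W) ρ).trace.re| +
      15 * d / (m * k₁ * k₂) * (0.01 * ε * (k₁ + k₂) / d * ‖offDiagQuery V W O‖) ≤ ε * ‖O‖ := by
  have hε := h.pos
  have hd := h.dim_large
  have hm := h.kraus_pos
  have hk₁ := h.left_pos
  have hk₂ := h.right_pos
  have hquery : 15 * d / (m * k₁ * k₂) * (0.01 * ε * (k₁ + k₂) / d * ‖offDiagQuery V W O‖) ≤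
      87 / 100 * ε * ‖O‖ :=
    calc _ = 3 / 20 * ε / (m * k₁ * k₂) * ((k₁ + k₂) * ‖offDiagQuery V W O‖) := by
          field_simp
          ring
      _ ≤ 3 / 20 * ε / (m * k₁ * k₂) * (29 / 5 * (m * k₁ * k₂ * ‖O‖)) :=
          mul_le_mul_of_nonneg_left (h.norm_offDiagQuery_le hW hV) (by positivity)
      _ = 87 / 100 * ε * ‖O‖ := by
          field_simp
          ring
  linarith [h.abs_trace_sub_le hρ hW hV]

lemma exists_algorithm {f : ℕ} (A : Algorithm (k₁ + k₂) f)
    (hA : A.Solves (0.01 * ε * (k₁ + k₂) / d) 0.9) :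
    ∃ B : Algorithm d f, B.Solves ε (657 / 1000) := by
  classical
  have hε := h.pos
  have hd := h.dim_large
  have hk₁ : 0 < k₁ := by exact_mod_cast h.left_pos
  rw [show (657 / 1000 : ℝ) = 0.9 * (73 / 100) by norm_num]
  refine exists_algorithm_of_subchannels A (s := 15 * d / (m * k₁ * k₂)) (by norm_num)
    (by positivity) (by positivity) hA finSumFinEquiv.symm (Sum.inl ⟨0, hk₁⟩)
    (G := (Fin k₂ × Fin m × Fin d → ZMod 4) × (Fin k₁ × Fin m × Fin d → ZMod 4))
    (fun g => if ‖stackMatrix (phaseMatrix g.2) (phaseMatrix g.1)‖ ^ 2 ≤ 30 * d then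
      blockKraus (30 * d) (phaseMatrix g.2) (phaseMatrix g.1) else 0)
    (fun g => ?_) (fun g => offDiagQuery (phaseMatrix g.2) (phaseMatrix g.1))
    (fun g O _ => isHermitian_offDiagQuery _ _ O) (fun g O => offDiagQuery_apply_self _ _ O _)
    fun ρ hρ O _ => ?_
  · split_ifs with hstack
    · exact posSemidef_one_sub_sum_blockKraus (by positivity) hstack
    · simpa using Matrix.PosSemidef.one
  · obtain ⟨T, hcard, hT⟩ := exists_finset_of_le_prob (h.prob_good_ge hρ O)
    refine ⟨T, hcard, fun g hg => ?_⟩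
    obtain ⟨hstack, hW, hV⟩ := hT g hg
    simpa only [if_pos hstack] using h.query_accuracy hρ hW hV

end CompressionRegime

end GoodPhases

section ZeroCopies

open scoped Matrix.Norms.L2Operator

/-- The algorithm that uses no copies and answers every query with `0`. -/
def zeroAlgorithm (d : ℕ) : Algorithm d 0 where
  Ω := Unit
  mΩ := inferInstance
  povm :=
    { μ := Measure.dirac ()
      sigmaFinite := inferInstance
      elem := fun _ => 1
      measurable_elem := fun _ _ => measurable_const
      posSemidef_elem := fun _ => Matrix.PosSemidef.one
      integrable_elem := fun _ _ => integrable_const _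
      integral_elem := fun _ _ => by rw [integral_dirac] }
  estimate := fun _ _ => 0
  measurable_estimate := fun _ _ => measurable_const

lemma zeroAlgorithm_solves {d : ℕ} {ε p : ℝ} (hε : 1 ≤ ε ∨ d = 0) (hp : p ≤ 1) :
    (zeroAlgorithm d).Solves ε p := by
  intro ρ hρ O _
  have hestimate (z) : |(O * ρ).trace.re - (zeroAlgorithm d).estimate O z| ≤ ε * opNorm O := by
    change |(O * ρ).trace.re - 0| ≤ ε * opNorm O
    rw [sub_zero]
    rcases hε with hε | rfl
    · exact (Complex.abs_re_le_norm _).trans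
        ((hρ.norm_trace_mul_le O).trans (le_mul_of_one_le_left (norm_nonneg _) hε))
    · exact absurd hρ.2 (by simp [Matrix.trace])
  have := (zeroAlgorithm d).povm.isProbabilityMeasure_law (isState_tensorPower (n := 0) hρ)
  simp only [hestimate, Set.ofPred_true, measure_univ]
  exact ENNReal.ofReal_le_one.mpr hp

end ZeroCopies

end Shadows

end

theorem mainTheorem3_general :
    ∃ C : ℝ, 0 < C ∧
      ∀ (d k : ℕ) (ε : ℝ), 0 < ε → k ≤ d → 100 * Real.sqrt d / ε ≤ k →
        ∀ f : ℕ, (∃ A : Shadows.Algorithm k f, A.Solves (0.01 * ε * k / d) 0.9) →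
          ∀ δ : ℝ, 0 < δ → δ ≤ 1 / 2 →
            ∃ n : ℕ, (n : ℝ) ≤ C * f * Real.log (1 / δ) ∧
              ∃ B : Shadows.Algorithm d n, B.Solves ε (1 - δ) := by
  refine ⟨23, by norm_num, fun d k ε hε hkd hk f ⟨A, hA⟩ δ hδ hδ' => ?_⟩
  have hlog : 0 ≤ Real.log (1 / δ) := Real.log_nonneg (by rw [le_div_iff₀ hδ]; linarith)
  by_cases htrivial : 1 ≤ ε ∨ d = 0
  · exact ⟨0, by rw [Nat.cast_zero]; positivity, Shadows.zeroAlgorithm d,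
      Shadows.zeroAlgorithm_solves htrivial (by linarith)⟩
  push Not at htrivial
  obtain ⟨k₁, k₂, m, rfl, hregime⟩ := Shadows.CompressionRegime.exists_of_sqrt_le hε
    htrivial.1.le (Nat.pos_of_ne_zero htrivial.2) hkd hk
  obtain ⟨B, hB⟩ := hregime.exists_algorithm A (by simpa only [Nat.cast_add] using hA)
  obtain ⟨N, hN, B', hB'⟩ := Shadows.exists_algorithm_boost hB (by norm_num) hδ hδ'
  refine ⟨N * f, ?_, B', hB'⟩
  calc ((N * f : ℕ) : ℝ) = N * f := Nat.cast_mul N f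
    _ ≤ (1 / (2 * (657 / 1000 - 1 / 2) ^ 2) + 2) * Real.log (1 / δ) * f := by gcongr
    _ ≤ 23 * Real.log (1 / δ) * f := by gcongr; norm_num
    _ = 23 * f * Real.log (1 / δ) := by ring

theorem mainTheorem3 :
    ∃ C : ℝ, 0 < C ∧
      ∀ (d k : ℕ) (ε : ℝ), 0 < ε → k ≤ d → 100 * Real.sqrt d / ε ≤ k →
        ∀ f : ℕ, (∃ A : Shadows.Algorithm k f, A.Solves (0.01 * ε * k / d) 0.9) →
          ∀ δ : ℝ, 0 < δ → δ ≤ 1 / 2 →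
            ∃ n : ℕ, (n : ℝ) ≤ C * (f + 1 / ε ^ 2) * Real.log (1 / δ) ∧
              ∃ B : Shadows.Algorithm d n, B.Solves ε (1 - δ) := by
  obtain ⟨C, hC, h⟩ := mainTheorem3_general
  refine ⟨C, hC, fun d k ε hε hkd hk f hf δ hδ hδ' => ?_⟩
  obtain ⟨n, hn, hB⟩ := h d k ε hε hkd hk f hf δ hδ hδ'
  refine ⟨n, hn.trans ?_, hB⟩
  have hlog : 0 ≤ Real.log (1 / δ) := Real.log_nonneg (by rw [le_div_iff₀ hδ]; linarith)
  gcongr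
  exact le_add_of_nonneg_right (by positivity)
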